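/- Let $\mathcal X$ be a data domain and let $f:\mathbb R^d\times\mathcal X\to\mathbb R$ ($d\ge 1$) be such that, for every $x\in\mathcal X$, $f(\cdot;x)$ is $L_0$-Lipschitz and $L_1$-smooth (differentiable with $L_1$-Lipschitz gradient); $f$ may be nonconvex. For a dataset $S=(x_1,\dots,x_n)\in\mathcal X^n$ ($n\ge1$) put $F(w;S)=\frac1n\sum_{i=1}^n f(w;x_i)$. Let $\rho,\beta,L_0,L_1>0$ with $\beta<n\sqrt\rho$, put $\Lambda=\log(n\sqrt\rho/\beta)>0$, and fix $w_0\in\mathbb R^d$. **Algorithm.** Adaptive Noisy Gradient Descent starts from $w_0$ with $t=0$. While $\sum_{j<t}\rho_j\le\rho/2$, it performs iteration $t$: - $N_t=\|\frac1n\sum_i\nabla f(w_t;x_i)\|+\hat b_t$ with $\hat b_t\sim\mathcal N(0,\hat\sigma^2)$, $\hat\sigma=\frac{L_0}{\sqrt n\,\rho^{1/4}}$; - $\nabla_t=\frac1n\sum_i\nabla f(w_t;x_i)+b_t$ with $b_t\sim\mathcal N(0,\sigma_t^2 I_d)$, $\sigma_t=\max\{\frac{N_t}{\sqrt{d\Lambda}},\frac{2L_0}{n\sqrt\rho}\}$;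 - $w_{t+1}=w_t-\frac1{2L_1}\nabla_t$; - $\rho_t=\min\{\frac{L_0^2d\Lambda}{n^2\max\{N_t,0\}^2},\frac\rho2\}+\frac{\sqrt\rho}{n}$, the minimum being $\frac\rho2$ if $N_t\le0$; - $t$ is increased by $1$. All noises are independent (given the past). Let $T+1$ be the largest value attained by $t$. Finally $t^*\in\{0,\dots,T\}$ is sampled with probability proportional to $\exp\big(-\frac{n\sqrt\rho}{2L_0}\|\nabla F(w_t;S)\|\big)$. **Privacy.** The algorithm is $2\rho$-zCDP, both when the whole transcript $(T,w_0,\dots,w_T,t^*)$ is released and when only $w_{t^*}$ is released. (An algorithm $\mathcal A$ is $\rho'$-zCDP if $D_\alpha(\mathcal A(S)\|\mathcal A(S'))\le\rho'\alpha$ for all $\alpha>1$ and all $S,S'\in\mathcal X^n$ differing in one data point, where $D_\alpha$ is the Rényi divergence of order $\alpha$.) **Convergence.** There is a universal constant $C>0$ such that, for all $f,d,n,\rho,\beta,L_0,L_1,w_0$ as above and every $S$ for which $F(\cdot;S)$ has a global minimizer $w^*$, if $F(w_0;S)-F(w^*;S)\le\Phi_0$ then, with probability at least $1-3\beta$, $$\|\nabla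 F(w_{t^*};S)\|\le C\left(\min\left\{\sqrt{\frac{\Phi_0L_1}{T}},\ \left(\frac{L_0\sqrt{\Phi_0L_1d\,\Lambda}}{n\sqrt\rho}\right)^{1/2}+\sqrt{\frac{\Phi_0L_1}{n\sqrt\rho}}\right\}+\frac{L_0\sqrt{\Lambda}}{\sqrt n\,\rho^{1/4}}\right),$$ where $\sqrt{\Phi_0L_1/T}$ is read as $+\infty$ when $T=0$. The term $\sqrt{\Phi_0L_1/(n\sqrt\rho)}$ is dominated by the one before it whenever $\Phi_0L_1\le L_0^2d\Lambda$. -/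

import Mathlib

open MeasureTheory ProbabilityTheory
open scoped ENNReal

noncomputable section

/-- `ℝ^d` with the Euclidean norm. -/
abbrev E (d : ℕ) : Type := EuclideanSpace ℝ (Fin d)

/-! ### Losses and empirical risk -/

/-- The loss `f(·; x)` is `L`-Lipschitz on `ℝ^d` for every data point `x`. -/
def IsLipschitzLoss {d : ℕ} {X : Type*} (f : E d → X → ℝ) (L : ℝ) : Prop :=
  ∀ x : X, ∀ w v : E d, |f w x - f v x| ≤ L * ‖w - v‖

/-- The loss `f(·; x)` is `L`-smooth for every data point `x`: it is differentiable and its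
gradient is `L`-Lipschitz. -/
def IsSmoothLoss {d : ℕ} {X : Type*} (f : E d → X → ℝ) (L : ℝ) : Prop :=
  ∀ x : X, Differentiable ℝ (fun w => f w x) ∧
    ∀ w v : E d, ‖gradient (fun u => f u x) w - gradient (fun u => f u x) v‖ ≤ L * ‖w - v‖

/-- The empirical risk `F(w; S) = (1/n) ∑ i, f(w; x_i)`. -/
def empiricalRisk {d n : ℕ} {X : Type*} (f : E d → X → ℝ) (S : Fin n → X) (w : E d) : ℝ :=
  (1 / (n : ℝ)) * ∑ i, f w (S i)

/-- The average `(1/n) ∑ i, ∇f(w; x_i)` of the per-sample gradients. -/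
def averageGradient {d n : ℕ} {X : Type*} (f : E d → X → ℝ) (S : Fin n → X) (w : E d) : E d :=
  (1 / (n : ℝ)) • ∑ i, gradient (fun u => f u (S i)) w

/-! ### Zero-concentrated differential privacy -/

/-- The Rényi divergence `D_α(P ‖ Q) = (α - 1)⁻¹ log ∫ (dP/dQ)^α dQ` of order `α > 1`,
equal to `+∞` when `P` is not absolutely continuous with respect to `Q`. -/
def renyiDivergence {Ω : Type*} [MeasurableSpace Ω] (α : ℝ) (P Q : Measure Ω) : EReal :=
  open Classical in
  if P ≪ Q then (((α - 1)⁻¹ : ℝ) : EReal) * ENNReal.log (∫⁻ ω, (P.rnDeriv Q ω) ^ α ∂Q) else ⊤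

/-- Two datasets of the same size differ in (at most) one data point. -/
def Neighbors {n : ℕ} {X : Type*} (S S' : Fin n → X) : Prop :=
  ∃ i, ∀ j, j ≠ i → S j = S' j

/-- A randomized algorithm, given by the law `A S` of its output on each dataset `S`,
is `ρ`-zCDP. -/
def IsZCDP {n : ℕ} {X Ω : Type*} [MeasurableSpace Ω] (A : (Fin n → X) → Measure Ω) (ρ : ℝ) :
    Prop :=
  (∀ S, IsProbabilityMeasure (A S)) ∧
    ∀ S S', Neighbors S S' → ∀ α : ℝ, 1 < α →
      renyiDivergence α (A S) (A S') ≤ ((ρ * α : ℝ) : EReal)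

/-! ### Adaptive noisy gradient descent -/

/-- The input parameters of the algorithm: privacy parameter, failure probability, Lipschitz
and smoothness parameters. -/
structure Params where
  ρ : ℝ
  β : ℝ
  L₀ : ℝ
  L₁ : ℝ

/-- The logarithmic factor `log (n √ρ / β)`. -/
def logFactor (P : Params) (n : ℕ) : ℝ := Real.log (n * √P.ρ / P.β)

/-- Standard deviation `σ̂ = L₀ / (√n ρ^{1/4})` of the noise on the gradient norm. -/
def normNoiseScale (P : Params) (n : ℕ) : ℝ := P.L₀ / (√n * P.ρ ^ (1 / 4 : ℝ))

/-- Noisy gradient norm `N_t`; `z` is a standard Gaussian, so that `σ̂ z ∼ N(0, σ̂²)`. -/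
def noisyNorm {d n : ℕ} {X : Type*} (P : Params) (f : E d → X → ℝ) (S : Fin n → X)
    (w : E d) (z : ℝ) : ℝ :=
  ‖averageGradient f S w‖ + normNoiseScale P n * z

/-- Noise level `σ_t = max {N_t / √(d log (n √ρ / β)), 2 L₀ / (n √ρ)}` as a function of `N_t`. -/
def gradNoiseScale (P : Params) (d n : ℕ) (N : ℝ) : ℝ :=
  max (N / √(d * logFactor P n)) (2 * P.L₀ / (n * √P.ρ))

/-- Privacy cost `ρ_t = min {L₀² d log (n √ρ / β) / (n² N²), ρ / 2} + √ρ / n` of an iteration,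
where `N = max {N_t, 0}` and the minimum is `ρ / 2` when `N = 0`. -/
def privacyCost (P : Params) (d n : ℕ) (Nt : ℝ) : ℝ :=
  (if 0 < Nt then min (P.L₀ ^ 2 * d * logFactor P n / ((n : ℝ) ^ 2 * Nt ^ 2)) (P.ρ / 2)
    else P.ρ / 2) + √P.ρ / n

/-- One iteration, with step size `η = 1 / (2 L₁)`. The state is the pair of the current
iterate and the privacy cost spent so far; the noise is a pair of standard Gaussians in `ℝ` and
`ℝ^d`, scaled by `σ̂` and by `σ_t`. -/
def agdStep {d n : ℕ} {X : Type*} (P : Params) (f : E d → X → ℝ) (S : Fin n → X)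
    (s : E d × ℝ) (ξ : ℝ × E d) : E d × ℝ :=
  let N := noisyNorm P f S s.1 ξ.1
  (s.1 - (1 / (2 * P.L₁)) • (averageGradient f S s.1 + gradNoiseScale P d n N • ξ.2),
    s.2 + privacyCost P d n N)

/-- The state before iteration `t` (with the stopping rule not yet applied), for the noise
sequence `ω`. -/
def agdState {d n : ℕ} {X : Type*} (P : Params) (f : E d → X → ℝ) (S : Fin n → X) (w₀ : E d)
    (ω : ℕ → ℝ × E d) : ℕ → E d × ℝ
  | 0 => (w₀, 0)
  | t + 1 => agdStep P f S (agdState P f S w₀ ω t) (ω t)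

/-- The index `T` of the last iteration that is performed. Iteration `t` is performed as long
as the cost `∑ j < t, ρ_j` spent before it is at most `ρ / 2`, so the counter stops at `T + 1`,
the first value for which the spent cost exceeds `ρ / 2`. -/
def lastIter {d n : ℕ} {X : Type*} (P : Params) (f : E d → X → ℝ) (S : Fin n → X) (w₀ : E d)
    (ω : ℕ → ℝ × E d) : ℕ :=
  sInf {t : ℕ | P.ρ / 2 < (agdState P f S w₀ ω (t + 1)).2}

/-- The law of the noise: independent standard Gaussians in `ℝ` and `ℝ^d` for all iterations. -/
def noiseLaw (d : ℕ) : Measure (ℕ → ℝ × E d) :=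
  Measure.infinitePi fun _ : ℕ => (gaussianReal 0 1).prod (stdGaussian (E d))

/-! ### Selection by the exponential mechanism and the full algorithm -/

/-- What is released: `T`, the iterates `w_0, …, w_T`, and the selected index `t*`. -/
abbrev Transcript (d : ℕ) : Type := Σ T : ℕ, (Fin (T + 1) → E d) × Fin (T + 1)

/-- The selected iterate `w_{t*}`. -/
def Transcript.selected {d : ℕ} (o : Transcript d) : E d := o.2.1 o.2.2

/-- The unnormalized weight `exp (- n √ρ / (2 L₀) ‖∇F(w; S)‖)` of an iterate. -/
def selectWeight {d n : ℕ} {X : Type*} (P : Params) (f : E d → X → ℝ) (S : Fin n → X)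
    (w : E d) : ℝ :=
  Real.exp (-(n * √P.ρ / (2 * P.L₀)) * ‖gradient (empiricalRisk f S) w‖)

/-- Given the trajectory `w_0, …, w_T`, the law of the transcript, in which `t*` is drawn from
`{0, …, T}` with probability proportional to `selectWeight`. -/
def selectLaw {d n : ℕ} {X : Type*} (P : Params) (f : E d → X → ℝ) (S : Fin n → X)
    (T : ℕ) (w : Fin (T + 1) → E d) : Measure (Transcript d) :=
  ∑ t : Fin (T + 1),
    ENNReal.ofReal (selectWeight P f S (w t) / ∑ s : Fin (T + 1), selectWeight P f S (w s)) •
      Measure.dirac (⟨T, w, t⟩ : Transcript d)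

/-- The law of the output (as a transcript) of the whole algorithm: run adaptive noisy gradient
descent from `w₀`, then select an iterate with the exponential mechanism. -/
def algorithmLaw {d n : ℕ} {X : Type*} (P : Params) (f : E d → X → ℝ) (w₀ : E d)
    (S : Fin n → X) : Measure (Transcript d) :=
  (noiseLaw d).bind fun ω =>
    selectLaw P f S (lastIter P f S w₀ ω) fun t => (agdState P f S w₀ ω t).1

/-- The convergence rate
`min {√(Φ₀ L₁ / T), (L₀ √(Φ₀ L₁ d log (n √ρ / β)) / (n √ρ))^{1/2} + √(Φ₀ L₁ / (n √ρ))}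
  + L₀ √(log (n √ρ / β)) / (√n ρ^{1/4})`,
where `√(Φ₀ L₁ / T)` counts as `+∞` for `T = 0`. -/
def stationarityRate (P : Params) (d n : ℕ) (Φ₀ : ℝ) (T : ℕ) : ℝ :=
  let worst := √(P.L₀ * √(Φ₀ * P.L₁ * d * logFactor P n) / (n * √P.ρ))
    + √(Φ₀ * P.L₁ / (n * √P.ρ))
  (if T = 0 then worst else min (√(Φ₀ * P.L₁ / T)) worst)
    + P.L₀ * √(logFactor P n) / (√n * P.ρ ^ (1 / 4 : ℝ))

end

/-! Privacy. The Rényi bound is proved in dual form (`renyiDivergence_le_of_dual`): expectations of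
nonnegative test functions `φ` on `S` are compared with `L^q` norms of `φ` on `S'`. This form
composes through the recursion `runValue`. With cost `s` already spent, `runValue_le_of_neighbors`
bounds the remaining loss by `3ρ/2 - 2s`. A continued iteration of cost `ρ_t` uses at most `2ρ_t`:
the noisy norm costs `2√ρ/n`, and given `N_t` the step is a Gaussian mechanism whose noise level no
longer depends on the data. Selection costs `ρ/2` by two uses of Hoeffding's lemma. The last
iteration may overshoot the budget, but its gradient noise is never released, so the total at `s =
0` is `3ρ/2 ≤ 2ρ`.

Convergence. If some visited gradient is at most `20 * noiseError`, the exponential mechanism finds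
a comparable one. Otherwise, outside rare events, every `N_t` is within ten percent of the true
gradient norm. Then the noise in a step is either proportional to the gradient, hence absorbed by
the descent, or at its floor, in which case the iteration spends at least `ρ/4`, so the budget
limits such steps.

Concentration comes from the potential `Q`: the scaled optimality gap, plus `floorError`, plus
`1/16` of the sum of squared gradients. Its relative changes have controlled exponential moments
(`lintegral_exp_step_le`), so `(Q/c)^(Λ/2)`, corrected by a factor in the unspent budget that stays
between `1` and `e^(1/4)`, is a supermartingale (`lintegral_excessBound_le`). Hence `Q` exceeds
`e^4` times the bound `Φ₀ L₁ + floorError` on its initial value with probability at most `β /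
(n√ρ)`.

When `Q` is bounded, the sum of squared gradients is bounded, while exhaustion of the budget bounds
the sum of the costs from below. Comparing the two (`exists_le_mul_optimizationError`) bounds the
smallest gradient by both terms of the minimum in the rate. Selection error, norm-noise tails and
potential excess contribute at most `β` each. Degenerate parameters and small initial gaps are
treated separately. -/

/-! ### Standard Gaussian measures: density, translation, exponential moments and tails. -/

section Gaussian

open Module
open scoped RealInnerProductSpace

variable {V : Type*} [NormedAddCommGroup V] [InnerProductSpace ℝ V]

/-- The density of the standard Gaussian. -/
noncomputable def stdGaussianDensity (x : V) : ℝ :=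
  (2 * Real.pi) ^ (-(finrank ℝ V / 2 : ℝ)) * Real.exp (-(1 / 2) * ‖x‖ ^ 2)

lemma stdGaussianDensity_nonneg (x : V) : 0 ≤ stdGaussianDensity x := by
  unfold stdGaussianDensity; positivity

variable [MeasurableSpace V] [BorelSpace V]

@[fun_prop]
lemma measurable_stdGaussianDensity : Measurable (stdGaussianDensity : V → ℝ) := by
  unfold stdGaussianDensity; fun_prop

variable [FiniteDimensional ℝ V]

lemma integrable_rexp_neg_mul_sq_norm_add {b : ℝ} (hb : 0 < b) (w : V) :
    Integrable (fun v : V => Real.exp (-b * ‖v‖ ^ 2 + ⟪w, v⟫)) := by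
  have h := (GaussianFourier.integrable_cexp_neg_mul_sq_norm_add
    (show 0 < (b : ℂ).re from hb) 1 w).norm
  refine h.congr (Filter.Eventually.of_forall fun v => ?_)
  simp only [Complex.norm_exp]
  congr 1
  simp [← Complex.ofReal_pow]

lemma integral_rexp_neg_mul_sq_norm_add {b : ℝ} (hb : 0 < b) (w : V) :
    ∫ v : V, Real.exp (-b * ‖v‖ ^ 2 + ⟪w, v⟫) =
      (Real.pi / b) ^ (finrank ℝ V / 2 : ℝ) * Real.exp (‖w‖ ^ 2 / (4 * b)) := by
  have h := GaussianFourier.integral_cexp_neg_mul_sq_norm_add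
    (show 0 < (b : ℂ).re from hb) 1 w
  rw [← Complex.ofReal_inj, ← integral_complex_ofReal]
  push_cast
  rw [Complex.ofReal_cpow (by positivity)]
  push_cast
  simpa using h

lemma lintegral_rexp_neg_mul_sq_norm_add {b : ℝ} (hb : 0 < b) (w : V) :
    ∫⁻ v : V, ENNReal.ofReal (Real.exp (-b * ‖v‖ ^ 2 + ⟪w, v⟫)) =
      ENNReal.ofReal
        ((Real.pi / b) ^ (finrank ℝ V / 2 : ℝ) * Real.exp (‖w‖ ^ 2 / (4 * b))) := by
  rw [← integral_rexp_neg_mul_sq_norm_add hb w, ofReal_integral_eq_lintegral_ofReal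
    (integrable_rexp_neg_mul_sq_norm_add hb w)
    (Filter.Eventually.of_forall fun _ => (Real.exp_pos _).le)]

-- Equality is checked on characteristic functions. The density reduces translations and exponential
-- moments to explicit Gaussian integrals.
variable (V) in
lemma stdGaussian_eq_withDensity :
    stdGaussian V = (volume : Measure V).withDensity
      fun x => ENNReal.ofReal (stdGaussianDensity x) := by
  have h2 : (0 : ℝ) < 2 * Real.pi := by positivity
  have hmass : ∫⁻ x : V, ENNReal.ofReal (stdGaussianDensity x) = 1 := by
    have h := lintegral_rexp_neg_mul_sq_norm_add (V := V) (b := 1 / 2) (by norm_num) 0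
    simp only [stdGaussianDensity]
    simp_rw [ENNReal.ofReal_mul (Real.rpow_nonneg h2.le _)]
    rw [lintegral_const_mul _ (by fun_prop)]
    simp only [inner_zero_left, add_zero] at h
    rw [h, ← ENNReal.ofReal_mul (Real.rpow_nonneg h2.le _)]
    have : Real.pi / (1 / 2) = 2 * Real.pi := by ring
    rw [this, ← mul_assoc, ← Real.rpow_add h2]
    simp
  have : IsProbabilityMeasure ((volume : Measure V).withDensity
      fun x => ENNReal.ofReal (stdGaussianDensity x)) :=
    ⟨by rw [withDensity_apply _ .univ, setLIntegral_univ, hmass]⟩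
  refine Measure.ext_of_charFun (funext fun t => ?_)
  rw [charFun_stdGaussian, charFun_apply, integral_withDensity_eq_integral_toReal_smul
    (by fun_prop) (Filter.Eventually.of_forall fun _ => ENNReal.ofReal_lt_top)]
  have h := GaussianFourier.integral_cexp_neg_mul_sq_norm_add
    (V := V) (b := 1 / 2) (by norm_num) Complex.I t
  have e : ∀ x : V, (ENNReal.ofReal (stdGaussianDensity x)).toReal •
      Complex.exp (⟪x, t⟫ * Complex.I) =
      (((2 * Real.pi) ^ (-(finrank ℝ V / 2 : ℝ)) : ℝ) : ℂ) *
        Complex.exp (-(1 / 2) * ‖x‖ ^ 2 + Complex.I * ⟪t, x⟫) := by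
    intro x
    rw [ENNReal.toReal_ofReal (stdGaussianDensity_nonneg x), stdGaussianDensity,
      Complex.real_smul, Complex.exp_add, real_inner_comm]
    push_cast
    ring_nf
  simp_rw [e]
  rw [integral_const_mul, h]
  have hp : ((Real.pi : ℂ) / (1 / 2)) ^ ((finrank ℝ V : ℂ) / 2) =
      (((2 * Real.pi) ^ (finrank ℝ V / 2 : ℝ) : ℝ) : ℂ) := by
    rw [Complex.ofReal_cpow h2.le]
    push_cast
    ring_nf
  rw [hp, ← mul_assoc, ← Complex.ofReal_mul, ← Real.rpow_add h2]
  simp only [neg_add_cancel, Real.rpow_zero, Complex.ofReal_one, one_mul, Complex.I_sq]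
  ring_nf

lemma lintegral_stdGaussian {φ : V → ℝ≥0∞} (hφ : Measurable φ) :
    ∫⁻ x, φ x ∂stdGaussian V = ∫⁻ x, ENNReal.ofReal (stdGaussianDensity x) * φ x := by
  rw [stdGaussian_eq_withDensity, lintegral_withDensity_eq_lintegral_mul _ (by fun_prop) hφ]
  rfl

/-- The Cameron-Martin formula. -/
lemma lintegral_stdGaussian_add {φ : V → ℝ≥0∞} (hφ : Measurable φ) (v : V) :
    ∫⁻ x, φ (x + v) ∂stdGaussian V =
      ∫⁻ x, φ x * ENNReal.ofReal (Real.exp (⟪v, x⟫ - ‖v‖ ^ 2 / 2)) ∂stdGaussian V := by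
  rw [lintegral_stdGaussian (by fun_prop), lintegral_stdGaussian (by fun_prop)]
  rw [← lintegral_sub_right_eq_self _ v]
  refine lintegral_congr fun x => ?_
  rw [sub_add_cancel, mul_comm (φ x), ← mul_assoc, ← ENNReal.ofReal_mul
    (stdGaussianDensity_nonneg x)]
  congr 2
  simp only [stdGaussianDensity]
  rw [mul_assoc, ← Real.exp_add, norm_sub_sq_real, real_inner_comm]
  ring_nf

/-- The quadratic term changes the precision from `1` to `1 - 2s`, whence `s < 1/2`. The case `s =
0` serves tails and Rényi moments; positive `s` handles the squared noise in the descent inequality.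
-/
lemma lintegral_exp_inner_add_sq_stdGaussian (u : V) {s : ℝ} (hs : s < 1 / 2) :
    ∫⁻ x, ENNReal.ofReal (Real.exp (⟪u, x⟫ + s * ‖x‖ ^ 2)) ∂stdGaussian V =
      ENNReal.ofReal ((1 - 2 * s) ^ (-(finrank ℝ V / 2 : ℝ)) *
        Real.exp (‖u‖ ^ 2 / (2 * (1 - 2 * s)))) := by
  have h2 : (0 : ℝ) < 2 * Real.pi := by positivity
  have hs' : 0 < 1 - 2 * s := by linarith
  rw [lintegral_stdGaussian (by fun_prop)]
  have e : ∀ x : V, ENNReal.ofReal (stdGaussianDensity x) *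
      ENNReal.ofReal (Real.exp (⟪u, x⟫ + s * ‖x‖ ^ 2)) =
      ENNReal.ofReal ((2 * Real.pi) ^ (-(finrank ℝ V / 2 : ℝ))) *
        ENNReal.ofReal (Real.exp (-(1 / 2 - s) * ‖x‖ ^ 2 + ⟪u, x⟫)) := by
    intro x
    rw [← ENNReal.ofReal_mul (stdGaussianDensity_nonneg x), ← ENNReal.ofReal_mul
      (Real.rpow_nonneg h2.le _), stdGaussianDensity, mul_assoc, ← Real.exp_add]
    ring_nf
  simp_rw [e]
  rw [lintegral_const_mul _ (by fun_prop), lintegral_rexp_neg_mul_sq_norm_add (by linarith),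
    ← ENNReal.ofReal_mul (Real.rpow_nonneg h2.le _), ← mul_assoc]
  have : Real.pi / (1 / 2 - s) = 2 * Real.pi * (1 - 2 * s)⁻¹ := by
    have : (1 / 2 - s) ≠ 0 := by linarith
    field_simp
  rw [this, Real.mul_rpow h2.le (by positivity), ← mul_assoc, ← Real.rpow_add h2,
    Real.inv_rpow hs'.le, ← Real.rpow_neg hs'.le]
  simp only [neg_add_cancel, Real.rpow_zero, one_mul]
  ring_nf

lemma gaussianReal_eq_stdGaussian : gaussianReal 0 1 = stdGaussian ℝ := by
  refine Measure.ext_of_charFun (funext fun t => ?_)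
  rw [charFun_gaussianReal, charFun_stdGaussian]
  simp [← Complex.ofReal_pow, neg_div]

/-- Chernoff's bound with the optimal parameter `r`, applied to each sign `c = ±1`. -/
lemma gaussianReal_abs_gt_le {r : ℝ} (hr : 0 ≤ r) :
    gaussianReal 0 1 {z | r < |z|} ≤ ENNReal.ofReal (2 * Real.exp (-(r ^ 2 / 2))) := by
  have key : ∀ c : ℝ, |c| = 1 → gaussianReal 0 1 {z | r < c * z} ≤
      ENNReal.ofReal (Real.exp (-(r ^ 2 / 2))) := by
    intro c hc
    have hc2 : c ^ 2 = 1 := by rw [← sq_abs, hc, one_pow]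
    have h := lintegral_exp_inner_add_sq_stdGaussian (r * c) (s := 0) (by norm_num)
    rw [← gaussianReal_eq_stdGaussian] at h
    calc gaussianReal 0 1 {z | r < c * z}
        ≤ gaussianReal 0 1 {z | ENNReal.ofReal (Real.exp (r ^ 2)) ≤
          ENNReal.ofReal (Real.exp (⟪r * c, z⟫ + 0 * ‖z‖ ^ 2))} := by
          refine measure_mono fun z hz => ?_
          refine ENNReal.ofReal_le_ofReal (Real.exp_le_exp.2 ?_)
          have hz' : r < c * z := hz
          have e : ⟪r * c, z⟫ = z * (r * c) := rfl
          rw [e]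
          nlinarith
      _ ≤ (∫⁻ z, ENNReal.ofReal (Real.exp (⟪r * c, z⟫ + 0 * ‖z‖ ^ 2)) ∂gaussianReal 0 1) /
          ENNReal.ofReal (Real.exp (r ^ 2)) :=
          meas_ge_le_lintegral_div (by fun_prop) (by simp [Real.exp_pos]) (by simp)
      _ = _ := by
          rw [h, ← ENNReal.ofReal_div_of_pos (Real.exp_pos _)]
          congr 1
          rw [Real.norm_eq_abs, abs_mul, hc]
          simp only [mul_one, sq_abs, mul_zero, sub_zero, Real.one_rpow, one_mul]
          rw [← Real.exp_sub]
          ring_nf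
  calc gaussianReal 0 1 {z | r < |z|}
      ≤ gaussianReal 0 1 ({z | r < 1 * z} ∪ {z | r < -1 * z}) := by
        refine measure_mono fun z hz => ?_
        simpa [lt_abs] using hz
    _ ≤ _ := measure_union_le _ _
    _ ≤ _ := add_le_add (key 1 (by simp)) (key (-1) (by simp))
    _ = _ := by
        rw [← ENNReal.ofReal_add (Real.exp_pos _).le (Real.exp_pos _).le]
        ring_nf

/-- Adding `v` to a standard Gaussian vector changes expectations in the sense of Rényi
divergence of order `p` by at most `‖v‖ ^ 2 / 2`. -/
lemma lintegral_stdGaussian_add_le {φ : V → ℝ≥0∞} (hφ : Measurable φ) (v : V) {p q : ℝ}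
    (hpq : p.HolderConjugate q) :
    ∫⁻ x, φ (x + v) ∂stdGaussian V ≤
      ENNReal.ofReal (Real.exp ((p - 1) * (‖v‖ ^ 2 / 2))) *
        (∫⁻ x, φ x ^ q ∂stdGaussian V) ^ (1 / q) := by
  rw [lintegral_stdGaussian_add hφ]
  refine (ENNReal.lintegral_mul_le_Lp_mul_Lq _ hpq.symm hφ.aemeasurable (by fun_prop)).trans ?_
  rw [mul_comm]
  gcongr
  have hp := hpq.pos
  have e : ∀ x : V, ENNReal.ofReal (Real.exp (⟪v, x⟫ - ‖v‖ ^ 2 / 2)) ^ p =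
      ENNReal.ofReal (Real.exp (-(p * (‖v‖ ^ 2 / 2)))) *
        ENNReal.ofReal (Real.exp (⟪p • v, x⟫ + 0 * ‖x‖ ^ 2)) := by
    intro x
    rw [ENNReal.ofReal_rpow_of_pos (Real.exp_pos _), ← Real.exp_mul,
      ← ENNReal.ofReal_mul (Real.exp_pos _).le, ← Real.exp_add, real_inner_smul_left]
    ring_nf
  simp_rw [e]
  rw [lintegral_const_mul _ (by fun_prop),
    lintegral_exp_inner_add_sq_stdGaussian _ (by norm_num), ← ENNReal.ofReal_mul
    (Real.exp_pos _).le]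
  simp only [mul_zero, sub_zero, Real.one_rpow, one_mul, mul_one]
  rw [← Real.exp_add, ENNReal.ofReal_rpow_of_pos (Real.exp_pos _), ← Real.exp_mul, norm_smul,
    Real.norm_eq_abs, abs_of_pos hp]
  refine ENNReal.ofReal_le_ofReal (Real.exp_le_exp.2 (le_of_eq ?_))
  field_simp
  ring

end Gaussian

/-! ### Rényi divergence by duality, and the exponential mechanism. -/

/-- Dual form of a bound on the Rényi divergence: by Hölder's inequality and its converse, it
suffices to compare the expectations of all nonnegative functions. -/
lemma renyiDivergence_le_of_dual {Ω : Type*} [MeasurableSpace Ω] {P Q : Measure Ω}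
    [IsFiniteMeasure P] [IsFiniteMeasure Q] {α q B : ℝ} (hq : α.HolderConjugate q)
    (h : ∀ φ : Ω → ℝ≥0∞, Measurable φ →
      ∫⁻ ω, φ ω ∂P ≤ ENNReal.ofReal (Real.exp ((α - 1) * B)) * (∫⁻ ω, φ ω ^ q ∂Q) ^ (1 / q)) :
    renyiDivergence α P Q ≤ ((α * B : ℝ) : EReal) := by
  have hα : 1 < α := hq.lt
  have hα0 : 0 < α := hq.pos
  have hq0 : 0 < q := hq.symm.pos
  have hac : P ≪ Q := by
    refine Measure.AbsolutelyContinuous.mk fun s hs hQ => ?_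
    have h1 := h (s.indicator 1) (measurable_one.indicator hs)
    have e : ∀ ω, (s.indicator (1 : Ω → ℝ≥0∞) ω) ^ q = s.indicator 1 ω := by
      intro ω
      by_cases hω : ω ∈ s <;> simp [hω, hq0]
    simp_rw [e] at h1
    rw [lintegral_indicator_one hs, lintegral_indicator_one hs, hQ,
      ENNReal.zero_rpow_of_pos (by positivity), mul_zero] at h1
    exact le_antisymm h1 bot_le
  set r := P.rnDeriv Q with hr
  have hrm : Measurable r := Measure.measurable_rnDeriv P Q
  -- Testing with the density to the power `α - 1` is the equality case of Hölder. Truncation at `k`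
  -- makes the integral `I` finite, so that `I ^ (1 / q)` can be cancelled; monotone convergence
  -- removes it afterwards.
  have hk : ∀ k : ℕ, ∫⁻ ω, (min (r ω) k) ^ α ∂Q ≤
      ENNReal.ofReal (Real.exp (α * (α - 1) * B)) := by
    intro k
    set I := ∫⁻ ω, (min (r ω) k) ^ α ∂Q with hI
    have hIfin : I ≠ ∞ := by
      refine ne_top_of_le_ne_top (b := ∫⁻ _, (k : ℝ≥0∞) ^ α ∂Q) ?_
        (lintegral_mono fun ω => by gcongr; exact min_le_right _ _)
      rw [lintegral_const]
      exact ENNReal.mul_ne_top (ENNReal.rpow_ne_top_of_nonneg hα0.le (by simp))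
        (measure_ne_top _ _)
    have h1 := h (fun ω => (min (r ω) k) ^ (α - 1)) (by fun_prop)
    have e1 : ∫⁻ ω, ((min (r ω) k) ^ (α - 1)) ^ q ∂Q = I := by
      refine lintegral_congr fun ω => ?_
      rw [← ENNReal.rpow_mul, hq.sub_one_mul_conj]
    have e2 : I ≤ ∫⁻ ω, (min (r ω) k) ^ (α - 1) ∂P := by
      rw [← Measure.withDensity_rnDeriv_eq P Q hac,
        lintegral_withDensity_eq_lintegral_mul _ hrm (by fun_prop)]
      refine lintegral_mono fun ω => ?_
      have : (min (r ω) (k : ℝ≥0∞)) ^ α = min (r ω) k * (min (r ω) k) ^ (α - 1) := by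
        conv_rhs => enter [1]; rw [← ENNReal.rpow_one (min (r ω) (k : ℝ≥0∞))]
        rw [← ENNReal.rpow_add_of_nonneg _ _ zero_le_one (by linarith)]
        congr 1; ring
      rw [this]
      exact mul_le_mul' (min_le_left _ _) le_rfl
    rw [e1] at h1
    have h2 : I ≤ ENNReal.ofReal (Real.exp ((α - 1) * B)) * I ^ (1 / q) := e2.trans h1
    by_cases hI0 : I = 0
    · rw [hI0]; exact bot_le
    have e3 : I = I ^ (1 / α) * I ^ (1 / q) := by
      rw [← ENNReal.rpow_add _ _ hI0 hIfin, one_div, one_div, hq.inv_add_inv_eq_one,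
        ENNReal.rpow_one]
    have hne0 : I ^ (1 / q) ≠ 0 := by
      simp [ENNReal.rpow_eq_zero_iff, hI0, hIfin]
    have hnet : I ^ (1 / q) ≠ ∞ := ENNReal.rpow_ne_top_of_nonneg (by positivity) hIfin
    have h3 : I ^ (1 / α) ≤ ENNReal.ofReal (Real.exp ((α - 1) * B)) := by
      nth_rewrite 1 [e3] at h2
      exact (ENNReal.mul_le_mul_iff_left hne0 hnet).1 h2
    have h4 := ENNReal.rpow_le_rpow h3 hα0.le
    rw [← ENNReal.rpow_mul, one_div_mul_cancel hα0.ne', ENNReal.rpow_one,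
      ENNReal.ofReal_rpow_of_pos (Real.exp_pos _), ← Real.exp_mul] at h4
    convert h4 using 3
    ring
  have hlim : ∫⁻ ω, r ω ^ α ∂Q ≤ ENNReal.ofReal (Real.exp (α * (α - 1) * B)) := by
    refine le_of_tendsto' (lintegral_tendsto_of_tendsto_of_monotone
      (f := fun (k : ℕ) ω => (min (r ω) k) ^ α) (fun k => by fun_prop) ?_ ?_) hk
    · refine Filter.Eventually.of_forall fun ω i j hij => ?_
      dsimp only
      gcongr
    · refine Filter.Eventually.of_forall fun ω => ?_
      have h1 : Filter.Tendsto (fun k : ℕ => min (r ω) (k : ℝ≥0∞)) Filter.atTop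
          (nhds (min (r ω) ⊤)) :=
        tendsto_const_nhds.min ENNReal.tendsto_nat_nhds_top
      rw [min_eq_left le_top] at h1
      exact (ENNReal.continuous_rpow_const.tendsto _).comp h1
  rw [renyiDivergence, if_pos hac]
  have hlog : ENNReal.log (∫⁻ ω, r ω ^ α ∂Q) ≤ ((α * (α - 1) * B : ℝ) : EReal) := by
    refine (ENNReal.log_monotone hlim).trans ?_
    rw [ENNReal.log_ofReal_of_pos (Real.exp_pos _), Real.log_exp]
  calc (((α - 1)⁻¹ : ℝ) : EReal) * ENNReal.log (∫⁻ ω, r ω ^ α ∂Q)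
      ≤ (((α - 1)⁻¹ : ℝ) : EReal) * ((α * (α - 1) * B : ℝ) : EReal) := by
        refine mul_le_mul_of_nonneg_left hlog ?_
        exact_mod_cast inv_nonneg.2 (by linarith : (0 : ℝ) ≤ α - 1)
    _ = ((α * B : ℝ) : EReal) := by
        rw [← EReal.coe_mul]
        congr 1
        have : α - 1 ≠ 0 := by linarith
        field_simp

/-- Hoeffding's lemma for finitely supported distributions. -/
lemma sum_mul_exp_le_of_abs_le {ι : Type*} [Fintype ι] {p v : ι → ℝ} (hp : ∀ t, 0 ≤ p t)
    (hp1 : ∑ t, p t = 1) {ε : ℝ} (hv : ∀ t, |v t| ≤ ε) (s : ℝ) :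
    ∑ t, p t * Real.exp (s * v t) ≤ Real.exp (s * ∑ t, p t * v t + s ^ 2 * ε ^ 2 / 2) := by
  let _ : MeasurableSpace ι := ⊤
  let μ : Measure ι := ∑ t, ENNReal.ofReal (p t) • Measure.dirac t
  have hμ : ∀ g : ι → ℝ, ∫ t, g t ∂μ = ∑ t, p t * g t := by
    intro g
    rw [integral_finsetSum_measure]
    · refine Finset.sum_congr rfl fun t _ => ?_
      rw [integral_smul_measure, integral_dirac, ENNReal.toReal_ofReal (hp t), smul_eq_mul]
    · intro t _
      exact (integrable_dirac (by simp)).smul_measure ENNReal.ofReal_ne_top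
  have : IsProbabilityMeasure μ := ⟨by
    simp only [μ, Measure.coe_finsetSum, Finset.sum_apply, Measure.smul_apply, measure_univ,
      smul_eq_mul, mul_one]
    rw [← ENNReal.ofReal_sum_of_nonneg fun t _ => hp t, hp1, ENNReal.ofReal_one]⟩
  have hsub := hasSubgaussianMGF_of_mem_Icc (μ := μ) (X := v) (a := -ε) (b := ε)
    (measurable_from_top).aemeasurable
    (Filter.Eventually.of_forall fun t => abs_le.1 (hv t))
  have h := hsub.mgf_le s
  rw [mgf, hμ, hμ] at h
  -- The range `[-ε, ε]` has half-width `ε`, which is why the variance proxy is `ε ^ 2`.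
  have e : ((((‖ε - -ε‖₊ / 2) ^ 2 : NNReal)) : ℝ) = ε ^ 2 := by
    push_cast
    rw [Real.norm_eq_abs, div_pow, sq_abs]; ring
  rw [e] at h
  set m := ∑ t, p t * v t
  calc ∑ t, p t * Real.exp (s * v t)
      = Real.exp (s * m) * ∑ t, p t * Real.exp (s * (v t - m)) := by
        rw [Finset.mul_sum]
        refine Finset.sum_congr rfl fun t _ => ?_
        rw [mul_left_comm, ← Real.exp_add]; ring_nf
    _ ≤ Real.exp (s * m) * Real.exp (ε ^ 2 * s ^ 2 / 2) := by gcongr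
    _ = _ := by rw [← Real.exp_add]; ring_nf

/-- Rényi divergence of the exponential mechanism, in dual form. -/
lemma sum_exp_div_mul_le {ι : Type*} [Fintype ι] [Nonempty ι] {x y : ι → ℝ} {ε : ℝ}
    (hxy : ∀ t, |x t - y t| ≤ ε) (φ : ι → ℝ≥0∞) {α q : ℝ} (hq : α.HolderConjugate q) :
    ∑ t, ENNReal.ofReal (Real.exp (x t) / ∑ s, Real.exp (x s)) * φ t ≤
      ENNReal.ofReal (Real.exp ((α - 1) * (ε ^ 2 / 2))) *
        (∑ t, ENNReal.ofReal (Real.exp (y t) / ∑ s, Real.exp (y s)) * φ t ^ q) ^ (1 / q) := by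
  have hα0 : 0 < α := hq.pos
  have hq0 : 0 < q := hq.symm.pos
  set A := ∑ s, Real.exp (x s) with hA
  set B := ∑ s, Real.exp (y s) with hB
  have hA0 : 0 < A := Finset.sum_pos (fun _ _ => Real.exp_pos _) Finset.univ_nonempty
  have hB0 : 0 < B := Finset.sum_pos (fun _ _ => Real.exp_pos _) Finset.univ_nonempty
  have ha : ∀ t, 0 < Real.exp (x t) / A := fun t => by positivity
  have hb : ∀ t, 0 < Real.exp (y t) / B := fun t => by positivity
  have hsum : ∑ t, Real.exp (x t) / A = 1 := by
    rw [← Finset.sum_div]; exact div_self hA0.ne'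
  have hinv : α⁻¹ + q⁻¹ = 1 := hq.inv_add_inv_eq_one
  have hratio : ∀ t, (Real.exp (x t) / A) / (Real.exp (y t) / B) =
      Real.exp (x t - y t) * (B / A) := by
    intro t
    rw [Real.exp_sub]; field_simp
  -- The ratio of normalizers is itself an exponential moment under the first distribution, so
  -- Hoeffding's lemma applies to it with `s = -1`.
  have hBA : B / A = ∑ t, Real.exp (x t) / A * Real.exp (-1 * (x t - y t)) := by
    rw [hB, Finset.sum_div]
    refine Finset.sum_congr rfl fun t _ => ?_
    rw [div_mul_eq_mul_div, ← Real.exp_add]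
    ring_nf
  set m := ∑ t, Real.exp (x t) / A * (x t - y t) with hm
  have hBA' : B / A ≤ Real.exp (-m + ε ^ 2 / 2) := by
    rw [hBA]
    have h := sum_mul_exp_le_of_abs_le (fun t => (ha t).le) hsum hxy (-1)
    rw [← hm] at h
    refine h.trans (le_of_eq ?_)
    ring_nf
  -- A second use of Hoeffding's lemma, with `s = α - 1`. The mean `m` cancels against the one from
  -- the normalizers, and `(α - 1) + (α - 1) ^ 2 = α * (α - 1)`.
  have hreal : ∑ t, Real.exp (y t) / B * (Real.exp (x t - y t) * (B / A)) ^ α ≤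
      Real.exp (α * (α - 1) * (ε ^ 2 / 2)) := by
    have e : ∀ t, Real.exp (y t) / B * (Real.exp (x t - y t) * (B / A)) ^ α =
        (B / A) ^ (α - 1) * (Real.exp (x t) / A * Real.exp ((α - 1) * (x t - y t))) := by
      intro t
      have h0 : 0 < Real.exp (x t - y t) * (B / A) := by positivity
      rw [show α = 1 + (α - 1) by ring, Real.rpow_add h0, Real.rpow_one,
        Real.mul_rpow (Real.exp_pos _).le (by positivity), ← Real.exp_mul]
      have : Real.exp (y t) / B * (Real.exp (x t - y t) * (B / A)) = Real.exp (x t) / A := by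
        rw [← hratio]; field_simp
      rw [← mul_assoc, this]
      ring_nf
    simp_rw [e]
    rw [← Finset.mul_sum]
    calc (B / A) ^ (α - 1) * ∑ t, Real.exp (x t) / A * Real.exp ((α - 1) * (x t - y t))
        ≤ (Real.exp (-m + ε ^ 2 / 2)) ^ (α - 1) *
          Real.exp ((α - 1) * m + (α - 1) ^ 2 * ε ^ 2 / 2) := by
          have h1 := hq.sub_one_pos
          have h2 := sum_mul_exp_le_of_abs_le (fun t => (ha t).le) hsum hxy (α - 1)
          gcongr
      _ = _ := by
          rw [← Real.exp_mul, ← Real.exp_add]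
          ring_nf
  have hsplit : ∀ t, ENNReal.ofReal (Real.exp (x t) / A) * φ t =
      (ENNReal.ofReal ((Real.exp (y t) / B) ^ α⁻¹ * (Real.exp (x t - y t) * (B / A)))) *
        (ENNReal.ofReal ((Real.exp (y t) / B) ^ q⁻¹) * φ t) := by
    intro t
    rw [← mul_assoc, ← ENNReal.ofReal_mul (by positivity)]
    congr 2
    rw [mul_right_comm, ← Real.rpow_add (hb t), hinv, Real.rpow_one, ← hratio]
    field_simp
  simp_rw [hsplit]
  refine (ENNReal.inner_le_Lp_mul_Lq Finset.univ _ _ hq).trans ?_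
  gcongr ?_ * ?_
  · have e : ∀ t, ENNReal.ofReal ((Real.exp (y t) / B) ^ α⁻¹ *
        (Real.exp (x t - y t) * (B / A))) ^ α =
        ENNReal.ofReal (Real.exp (y t) / B * (Real.exp (x t - y t) * (B / A)) ^ α) := by
      intro t
      rw [ENNReal.ofReal_rpow_of_pos (by positivity), Real.mul_rpow (by positivity)
        (by positivity), ← Real.rpow_mul (hb t).le, inv_mul_cancel₀ hα0.ne', Real.rpow_one]
    simp_rw [e]
    rw [← ENNReal.ofReal_sum_of_nonneg fun t _ => by positivity]
    refine (ENNReal.rpow_le_rpow (ENNReal.ofReal_le_ofReal hreal) (by positivity)).trans ?_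
    rw [ENNReal.ofReal_rpow_of_pos (Real.exp_pos _), ← Real.exp_mul]
    refine ENNReal.ofReal_le_ofReal (Real.exp_le_exp.2 (le_of_eq ?_))
    field_simp
  · refine ENNReal.rpow_le_rpow (Finset.sum_le_sum fun t _ => ?_) (by positivity)
    rw [ENNReal.mul_rpow_of_nonneg _ _ hq0.le, ENNReal.ofReal_rpow_of_pos
      (by have := hb t; positivity), ← Real.rpow_mul (hb t).le, inv_mul_cancel₀ hq0.ne',
      Real.rpow_one]

/-! ### Gradients of the empirical risk: smoothness, size and sensitivity. -/

section Gradient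

variable {d n : ℕ} {X : Type*} {f : E d → X → ℝ} {S S' : Fin n → X} {L₀ L₁ : ℝ}

lemma hasGradientAt_of_isSmoothLoss (h : IsSmoothLoss f L₁) (x : X) (w : E d) :
    HasGradientAt (fun u => f u x) (gradient (fun u => f u x) w) w :=
  ((h x).1 w).hasGradientAt

lemma hasGradientAt_empiricalRisk (h : IsSmoothLoss f L₁) (S : Fin n → X) (w : E d) :
    HasGradientAt (empiricalRisk f S) (averageGradient f S w) w := by
  have h1 : HasFDerivAt (fun w => (1 / (n : ℝ)) * ∑ i, f w (S i))
      ((1 / (n : ℝ)) • ∑ i, (InnerProductSpace.toDual ℝ (E d))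
        (gradient (fun u => f u (S i)) w)) w :=
    (HasFDerivAt.fun_sum fun i _ =>
      (hasGradientAt_of_isSmoothLoss h (S i) w).hasFDerivAt).const_mul _
  rw [hasGradientAt_iff_hasFDerivAt, averageGradient, map_smul, map_sum]
  exact h1

lemma gradient_empiricalRisk (h : IsSmoothLoss f L₁) (S : Fin n → X) (w : E d) :
    gradient (empiricalRisk f S) w = averageGradient f S w :=
  (hasGradientAt_empiricalRisk h S w).gradient

lemma norm_averageGradient_sub_le (hn : 0 < n) (h : IsSmoothLoss f L₁) (S : Fin n → X)
    (w v : E d) : ‖averageGradient f S w - averageGradient f S v‖ ≤ L₁ * ‖w - v‖ := by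
  have hn' : (0 : ℝ) < n := by exact_mod_cast hn
  rw [averageGradient, averageGradient, ← smul_sub, ← Finset.sum_sub_distrib, norm_smul,
    Real.norm_of_nonneg (by positivity)]
  calc 1 / (n : ℝ) * ‖_‖ ≤ 1 / (n : ℝ) * ∑ i : Fin n, L₁ * ‖w - v‖ := by
        gcongr
        exact norm_sum_le_of_le _ fun i _ => (h (S i)).2 w v
    _ = L₁ * ‖w - v‖ := by
        simp only [Finset.sum_const, Finset.card_univ, Fintype.card_fin, nsmul_eq_mul]
        field_simp

lemma continuous_averageGradient (hn : 0 < n) (h : IsSmoothLoss f L₁) (S : Fin n → X) :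
    Continuous (averageGradient f S) := by
  refine (LipschitzWith.of_dist_le' (K := L₁) fun w v => ?_).continuous
  rw [dist_eq_norm, dist_eq_norm]
  exact norm_averageGradient_sub_le hn h S w v

lemma norm_gradient_le (hL : 0 < L₀) (h : IsLipschitzLoss f L₀) (x : X) (w : E d) :
    ‖gradient (fun u => f u x) w‖ ≤ L₀ := by
  have h1 : LipschitzWith (Real.toNNReal L₀) fun u => f u x :=
    LipschitzWith.of_dist_le' fun w v => by
      rw [dist_eq_norm, dist_eq_norm]; exact h x w v
  have h2 := norm_fderiv_le_of_lipschitz ℝ h1 (x₀ := w)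
  rw [Real.coe_toNNReal _ hL.le] at h2
  rwa [gradient, LinearIsometryEquiv.norm_map]

lemma norm_averageGradient_le (hL : 0 < L₀) (hn : 0 < n) (h : IsLipschitzLoss f L₀)
    (S : Fin n → X) (w : E d) : ‖averageGradient f S w‖ ≤ L₀ := by
  have hn' : (0 : ℝ) < n := by exact_mod_cast hn
  rw [averageGradient, norm_smul, Real.norm_of_nonneg (by positivity)]
  calc 1 / (n : ℝ) * ‖_‖ ≤ 1 / (n : ℝ) * ∑ i : Fin n, L₀ := by
        gcongr
        exact norm_sum_le_of_le _ fun i _ => norm_gradient_le hL h (S i) w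
    _ = L₀ := by
        simp only [Finset.sum_const, Finset.card_univ, Fintype.card_fin, nsmul_eq_mul]
        field_simp

lemma norm_averageGradient_sub_le_of_neighbors (hL : 0 < L₀)
    (h : IsLipschitzLoss f L₀) (hS : Neighbors S S') (w : E d) :
    ‖averageGradient f S w - averageGradient f S' w‖ ≤ 2 * L₀ / n := by
  obtain ⟨i, hi⟩ := hS
  rw [averageGradient, averageGradient, ← smul_sub, ← Finset.sum_sub_distrib, norm_smul,
    Real.norm_of_nonneg (by positivity), Finset.sum_eq_single i]
  · calc 1 / (n : ℝ) * ‖_‖ ≤ 1 / (n : ℝ) * (L₀ + L₀) := by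
          gcongr
          exact (norm_sub_le _ _).trans
            (add_le_add (norm_gradient_le hL h _ w) (norm_gradient_le hL h _ w))
      _ = 2 * L₀ / n := by ring
  · intro j _ hj
    rw [hi j hj, sub_self]
  · simp

end Gradient

/-! ### The algorithm as a recursion over fresh noise. -/

section Run

variable {d n : ℕ} {X : Type*} {P : Params} {f : E d → X → ℝ} {S : Fin n → X}
  {φ : Transcript d → ℝ≥0∞}

/-- The expectation of `φ` under the selection step for the trajectory `u 0, …, u j`. -/
noncomputable def selectValue (P : Params) (f : E d → X → ℝ) (S : Fin n → X)
    (φ : Transcript d → ℝ≥0∞) (j : ℕ) (u : ℕ → E d) : ℝ≥0∞ :=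
  ∑ t : Fin (j + 1), ENNReal.ofReal (selectWeight P f S (u t) /
    ∑ s : Fin (j + 1), selectWeight P f S (u s)) * φ ⟨j, fun t => u t, t⟩

/-- The expectation of `φ` under at most `k` further iterations, started after the iterates
`u 0, …, u j` with privacy cost `s` spent. -/
noncomputable def runValue (P : Params) (f : E d → X → ℝ) (S : Fin n → X)
    (φ : Transcript d → ℝ≥0∞) : ℕ → ℕ → (ℕ → E d) → ℝ → ℝ≥0∞
  -- The default `0` makes the base case of every upper bound trivial; it is never reached when `k`
  -- exceeds the possible number of iterations.
  | 0, _, _, _ => 0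
  -- The iteration that exhausts the budget is counted, so `T = j`, but the iterate it produces is
  -- discarded.
  | k + 1, j, u, s => ∫⁻ ξ, (if P.ρ / 2 < (agdStep P f S (u j, s) ξ).2 then
        selectValue P f S φ j u
      else runValue P f S φ k (j + 1) (Function.update u (j + 1) (agdStep P f S (u j, s) ξ).1)
        (agdStep P f S (u j, s) ξ).2) ∂(gaussianReal 0 1).prod (stdGaussian (E d))

/-- The value of at most `k` further iterations for a fixed noise sequence. -/
noncomputable def pathValue (P : Params) (f : E d → X → ℝ) (S : Fin n → X)
    (φ : Transcript d → ℝ≥0∞) : ℕ → ℕ → (ℕ → E d) → ℝ → (ℕ → ℝ × E d) → ℝ≥0∞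
  | 0, _, _, _, _ => 0
  | k + 1, j, u, s, ω => if P.ρ / 2 < (agdStep P f S (u j, s) (ω 0)).2 then
        selectValue P f S φ j u
      else pathValue P f S φ k (j + 1)
        (Function.update u (j + 1) (agdStep P f S (u j, s) (ω 0)).1)
        (agdStep P f S (u j, s) (ω 0)).2 fun i => ω (i + 1)

lemma measurable_sigmaMk {ι : Type*} {β : ι → Type*} [∀ i, MeasurableSpace (β i)] (i : ι) :
    Measurable (Sigma.mk i : β i → Sigma β) := by
  intro s hs
  exact (MeasurableSpace.measurableSet_iInf.1 hs) i

lemma measurable_privacyCost : Measurable (privacyCost P d n) := by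
  unfold privacyCost
  refine Measurable.add_const (Measurable.ite (measurableSet_lt measurable_const measurable_id)
    ?_ measurable_const) _
  fun_prop

@[fun_prop]
lemma measurable_agdStep (hg : Measurable (averageGradient f S)) :
    Measurable fun p : (E d × ℝ) × (ℝ × E d) => agdStep P f S p.1 p.2 := by
  unfold agdStep
  have hN : Measurable fun p : (E d × ℝ) × (ℝ × E d) => noisyNorm P f S p.1.1 p.2.1 := by
    unfold noisyNorm; fun_prop
  have hσ : Measurable fun p : (E d × ℝ) × (ℝ × E d) =>
      gradNoiseScale P d n (noisyNorm P f S p.1.1 p.2.1) := by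
    unfold gradNoiseScale; fun_prop
  have hc := (measurable_privacyCost (P := P) (d := d) (n := n)).comp hN
  simp only [Function.comp_def] at hc
  refine Measurable.prodMk ?_ ?_
  · fun_prop
  · fun_prop

lemma measurable_selectWeight (hg : Measurable fun w => gradient (empiricalRisk f S) w) :
    Measurable (selectWeight P f S) := by
  unfold selectWeight; fun_prop

lemma measurable_selectValue (hg : Measurable fun w => gradient (empiricalRisk f S) w)
    (hφ : Measurable φ) (j : ℕ) : Measurable (selectValue P f S φ j) := by
  have := measurable_selectWeight (P := P) hg
  unfold selectValue
  refine Finset.measurable_sum _ fun t _ => Measurable.mul (by fun_prop) ?_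
  have h1 : Measurable fun u : ℕ → E d =>
      ((fun t => u t, t) : (Fin (j + 1) → E d) × Fin (j + 1)) := by fun_prop
  exact hφ.comp ((measurable_sigmaMk j).comp h1)

lemma measurable_update_const {α β : Type*} [MeasurableSpace α] [MeasurableSpace β]
    {u : α → ℕ → β} {v : α → β} (hu : Measurable u) (hv : Measurable v) (j : ℕ) :
    Measurable fun a => Function.update (u a) j (v a) := by
  refine measurable_pi_iff.2 fun i => ?_
  by_cases h : i = j
  · subst h; simpa using hv
  · simpa [Function.update_of_ne h] using (measurable_pi_iff.1 hu i)

lemma measurable_runValue (hg : Measurable (averageGradient f S))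
    (hge : Measurable fun w => gradient (empiricalRisk f S) w)
    (hφ : Measurable φ) (k j : ℕ) :
    Measurable fun p : (ℕ → E d) × ℝ => runValue P f S φ k j p.1 p.2 := by
  induction k generalizing j with
  | zero => simp only [runValue]; fun_prop
  | succ k ih =>
    simp only [runValue]
    have hstep : Measurable fun p : ((ℕ → E d) × ℝ) × (ℝ × E d) =>
        agdStep P f S (p.1.1 j, p.1.2) p.2 :=
      (measurable_agdStep hg).comp (f := fun p : ((ℕ → E d) × ℝ) × (ℝ × E d) =>
        ((p.1.1 j, p.1.2), p.2)) (by fun_prop)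
    refine Measurable.lintegral_prod_right' (ν := (gaussianReal 0 1).prod (stdGaussian (E d)))
      (f := fun p : ((ℕ → E d) × ℝ) × (ℝ × E d) =>
        if P.ρ / 2 < (agdStep P f S (p.1.1 j, p.1.2) p.2).2 then selectValue P f S φ j p.1.1
        else runValue P f S φ k (j + 1)
          (Function.update p.1.1 (j + 1) (agdStep P f S (p.1.1 j, p.1.2) p.2).1)
          (agdStep P f S (p.1.1 j, p.1.2) p.2).2) ?_
    refine Measurable.ite (measurableSet_lt measurable_const hstep.snd) ?_ ?_
    · exact (measurable_selectValue hge hφ j).comp (by fun_prop)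
    · exact (ih (j + 1)).comp
        ((measurable_update_const (by fun_prop) hstep.fst _).prodMk hstep.snd)

lemma measurable_pathValue (hg : Measurable (averageGradient f S))
    (hge : Measurable fun w => gradient (empiricalRisk f S) w)
    (hφ : Measurable φ) (k j : ℕ) :
    Measurable fun p : ((ℕ → E d) × ℝ) × (ℕ → ℝ × E d) =>
      pathValue P f S φ k j p.1.1 p.1.2 p.2 := by
  induction k generalizing j with
  | zero => simp only [pathValue]; fun_prop
  | succ k ih =>
    simp only [pathValue]
    have hstep : Measurable fun p : ((ℕ → E d) × ℝ) × (ℕ → ℝ × E d) =>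
        agdStep P f S (p.1.1 j, p.1.2) (p.2 0) :=
      (measurable_agdStep hg).comp (f := fun p : ((ℕ → E d) × ℝ) × (ℕ → ℝ × E d) =>
        ((p.1.1 j, p.1.2), p.2 0)) (by fun_prop)
    refine Measurable.ite (measurableSet_lt measurable_const hstep.snd) ?_ ?_
    · exact (measurable_selectValue hge hφ j).comp (by fun_prop)
    · refine (ih (j + 1)).comp (f := fun p : ((ℕ → E d) × ℝ) × (ℕ → ℝ × E d) =>
        ((Function.update p.1.1 (j + 1) (agdStep P f S (p.1.1 j, p.1.2) (p.2 0)).1,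
          (agdStep P f S (p.1.1 j, p.1.2) (p.2 0)).2), fun i => p.2 (i + 1)))
        (((measurable_update_const (by fun_prop) hstep.fst _).prodMk hstep.snd).prodMk ?_)
      fun_prop

/-- The first coordinate of an i.i.d. sequence is independent of the shifted sequence. -/
lemma map_infinitePi_head_tail {Ω : Type*} [MeasurableSpace Ω] (μ : Measure Ω)
    [IsProbabilityMeasure μ] :
    (Measure.infinitePi fun _ : ℕ => μ).map (fun ω => (ω 0, fun i => ω (i + 1))) =
      μ.prod (Measure.infinitePi fun _ : ℕ => μ) := by
  let cons : Ω × (ℕ → Ω) → ℕ → Ω := fun p i => Nat.casesOn i p.1 p.2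
  have hcons : Measurable cons := by
    refine measurable_pi_iff.2 fun i => ?_
    cases i with
    | zero => exact measurable_fst
    | succ i => exact (measurable_pi_apply i).comp measurable_snd
  have h : (μ.prod (Measure.infinitePi fun _ : ℕ => μ)).map cons =
      Measure.infinitePi fun _ : ℕ => μ := by
    -- It suffices to test finite boxes. Padding with `Set.univ` makes the index set an initial
    -- segment, which splits into its head and a shifted segment.
    refine Measure.eq_infinitePi _ fun s t ht => ?_
    have hN : ∃ N, s ⊆ Finset.range (N + 1) :=
      ⟨s.sup id, fun i hi => Finset.mem_range.2
        (Nat.lt_succ_of_le (Finset.le_sup (f := id) hi))⟩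
    obtain ⟨N, hN⟩ := hN
    classical
    let t' : ℕ → Set Ω := fun i => if i ∈ s then t i else Set.univ
    have ht' : ∀ i, MeasurableSet (t' i) := by
      intro i; by_cases hi : i ∈ s <;> simp [t', hi, ht i]
    have e1 : Set.pi (s : Set ℕ) t = Set.pi (Finset.range (N + 1) : Set ℕ) t' := by
      ext ω
      simp only [Set.mem_pi, Finset.mem_coe]
      constructor
      · intro h i _
        by_cases hi : i ∈ s
        · simpa [t', hi] using h i hi
        · simp [t', hi]
      · intro h i hi
        simpa [t', hi] using h i (hN hi)
    have e2 : ∏ i ∈ s, μ (t i) = ∏ i ∈ Finset.range (N + 1), μ (t' i) := by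
      rw [← Finset.prod_subset hN]
      · exact Finset.prod_congr rfl fun i hi => by simp [t', hi]
      · intro i _ hi; simp [t', hi]
    rw [e1, e2, Measure.map_apply hcons
      (MeasurableSet.pi (Finset.countable_toSet _) fun i _ => ht' i)]
    have e3 : cons ⁻¹' Set.pi (Finset.range (N + 1) : Set ℕ) t' =
        t' 0 ×ˢ Set.pi (Finset.range N : Set ℕ) fun i => t' (i + 1) := by
      ext ⟨x, ω⟩
      simp only [Set.mem_preimage, Set.mem_pi, Finset.mem_coe, Finset.mem_range, Set.mem_prod]
      constructor
      · exact fun h => ⟨h 0 (by omega), fun i hi => h (i + 1) (by omega)⟩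
      · rintro ⟨h0, h⟩ (_ | i) hi
        · exact h0
        · exact h i (by omega)
    rw [e3, Measure.prod_prod, Measure.infinitePi_pi _ fun i _ => ht' (i + 1),
      Finset.prod_range_succ' , mul_comm]
  rw [← h, Measure.map_map (by fun_prop) hcons]
  have : (fun ω : ℕ → Ω => (ω 0, fun i => ω (i + 1))) ∘ cons = id := rfl
  rw [this, Measure.map_id]
  rw [h]

instance isProbabilityMeasure_noiseLaw : IsProbabilityMeasure (noiseLaw d) := by
  unfold noiseLaw; infer_instance

lemma lintegral_noiseLaw_head_tail {F : (ℝ × E d) × (ℕ → ℝ × E d) → ℝ≥0∞} (hF : Measurable F) :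
    ∫⁻ ω, F (ω 0, fun i => ω (i + 1)) ∂noiseLaw d =
      ∫⁻ ξ, ∫⁻ ω, F (ξ, ω) ∂noiseLaw d ∂(gaussianReal 0 1).prod (stdGaussian (E d)) := by
  rw [← lintegral_prod _ hF.aemeasurable]
  unfold noiseLaw
  rw [← map_infinitePi_head_tail, lintegral_map hF (by fun_prop)]

/-- An iteration reads only the head of the noise sequence and its continuation only the tail.
Independence of the two turns the integral over paths into nested integrals. -/
lemma lintegral_pathValue (hg : Measurable (averageGradient f S))
    (hge : Measurable fun w => gradient (empiricalRisk f S) w)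
    (hφ : Measurable φ) (k j : ℕ) (u : ℕ → E d) (s : ℝ) :
    ∫⁻ ω, pathValue P f S φ k j u s ω ∂noiseLaw d = runValue P f S φ k j u s := by
  induction k generalizing j u s with
  | zero => simp [pathValue, runValue]
  | succ k ih =>
    simp only [pathValue, runValue]
    have hstep : Measurable fun p : (ℝ × E d) × (ℕ → ℝ × E d) =>
        agdStep P f S (u j, s) p.1 :=
      (measurable_agdStep hg).comp (f := fun p : (ℝ × E d) × (ℕ → ℝ × E d) =>
        ((u j, s), p.1)) (by fun_prop)
    rw [lintegral_noiseLaw_head_tail (F := fun p => if P.ρ / 2 < (agdStep P f S (u j, s) p.1).2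
      then selectValue P f S φ j u else pathValue P f S φ k (j + 1)
        (Function.update u (j + 1) (agdStep P f S (u j, s) p.1).1)
        (agdStep P f S (u j, s) p.1).2 p.2)]
    · refine lintegral_congr fun ξ => ?_
      by_cases h : P.ρ / 2 < (agdStep P f S (u j, s) ξ).2
      · simp only [h, if_true, lintegral_const, measure_univ, mul_one]
      · simp only [h, if_false]
        exact ih _ _ _
    · refine Measurable.ite (measurableSet_lt measurable_const hstep.snd) measurable_const ?_
      exact (measurable_pathValue hg hge hφ k (j + 1)).comp
        (f := fun p : (ℝ × E d) × (ℕ → ℝ × E d) =>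
          ((Function.update u (j + 1) (agdStep P f S (u j, s) p.1).1,
            (agdStep P f S (u j, s) p.1).2), p.2))
        (((measurable_update_const measurable_const hstep.fst _).prodMk hstep.snd).prodMk
          measurable_snd)

end Run

/-! ### Identification of the law of the algorithm with the recursion. -/

section Law

variable {d n : ℕ} {X : Type*} {P : Params} {f : E d → X → ℝ} {S : Fin n → X} {w₀ : E d}
  {φ : Transcript d → ℝ≥0∞}

lemma privacyCost_ge (hd : 0 < d) (hn : 0 < n) (hρ : 0 < P.ρ) (hΛ : 0 < logFactor P n) (N : ℝ) :
    √P.ρ / n ≤ privacyCost P d n N := by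
  unfold privacyCost
  have : 0 ≤ if 0 < N then min (P.L₀ ^ 2 * d * logFactor P n / ((n : ℝ) ^ 2 * N ^ 2)) (P.ρ / 2)
    else P.ρ / 2 := by
    split_ifs
    · exact le_min (by positivity) (by positivity)
    · positivity
  linarith

lemma selectWeight_pos (w : E d) : 0 < selectWeight P f S w := Real.exp_pos _

lemma selectValue_congr {j : ℕ} {u v : ℕ → E d} (h : ∀ t ≤ j, u t = v t) :
    selectValue P f S φ j u = selectValue P f S φ j v := by
  have h' : ∀ t : Fin (j + 1), u t = v t := fun t => h t (Nat.lt_succ_iff.1 t.2)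
  simp only [selectValue, h']

lemma lintegral_selectLaw (hφ : Measurable φ) (j : ℕ) (u : ℕ → E d) :
    ∫⁻ o, φ o ∂selectLaw P f S j (fun t => u t) = selectValue P f S φ j u := by
  unfold selectLaw selectValue
  rw [lintegral_finsetSum_measure]
  refine Finset.sum_congr rfl fun t _ => ?_
  rw [lintegral_smul_measure, lintegral_dirac' _ hφ, smul_eq_mul]

lemma selectValue_one (j : ℕ) (u : ℕ → E d) : selectValue P f S (fun _ => 1) j u = 1 := by
  have h : 0 < ∑ s : Fin (j + 1), selectWeight P f S (u s) :=
    Finset.sum_pos (fun _ _ => selectWeight_pos _) Finset.univ_nonempty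
  simp only [selectValue, mul_one]
  rw [← ENNReal.ofReal_sum_of_nonneg fun t _ => div_nonneg (selectWeight_pos _).le h.le,
    ← Finset.sum_div, div_self h.ne', ENNReal.ofReal_one]

lemma selectValue_mono {φ ψ : Transcript d → ℝ≥0∞} (h : ∀ o, φ o ≤ ψ o) (j : ℕ)
    (u : ℕ → E d) : selectValue P f S φ j u ≤ selectValue P f S ψ j u := by
  unfold selectValue
  gcongr
  exact h _

lemma measurable_agdState (hg : Measurable (averageGradient f S)) (t : ℕ) :
    Measurable fun ω => agdState P f S w₀ ω t := by
  induction t with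
  | zero => exact measurable_const
  | succ t ih =>
    exact (measurable_agdStep hg).comp (ih.prodMk (measurable_pi_apply t))

/-- A first hitting time; `hexit` excludes the default value of `sInf` on the empty set. -/
lemma measurable_lastIter (hexit : ∀ ω, ∃ t, P.ρ / 2 < (agdState P f S w₀ ω (t + 1)).2)
    (hg : Measurable (averageGradient f S)) :
    Measurable (lastIter P f S w₀) := by
  classical
  have h := measurable_find hexit fun k =>
    measurableSet_lt measurable_const (measurable_agdState (P := P) (w₀ := w₀) hg (k + 1)).snd
  convert h using 2 with ω
  exact Nat.sInf_def (hexit ω)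

lemma measurable_selectLaw (hexit : ∀ ω, ∃ t, P.ρ / 2 < (agdState P f S w₀ ω (t + 1)).2)
    (hg : Measurable (averageGradient f S))
    (hge : Measurable fun w => gradient (empiricalRisk f S) w) :
    Measurable fun ω => selectLaw P f S (lastIter P f S w₀ ω)
      fun t => (agdState P f S w₀ ω t).1 := by
  refine Measure.measurable_of_measurable_coe _ fun s hs => ?_
  have hm : Measurable fun p : ℕ × (ℕ → ℝ × E d) =>
      selectValue P f S (s.indicator 1) p.1 fun t => (agdState P f S w₀ p.2 t).1 := by
    refine measurable_from_prod_countable_right fun j => ?_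
    exact (measurable_selectValue hge (measurable_one.indicator hs) j).comp
      (measurable_pi_iff.2 fun t => (measurable_agdState hg t).fst)
  have h := hm.comp ((measurable_lastIter hexit hg).prodMk measurable_id)
  convert h using 2 with ω
  simp only [Function.comp_apply, id]
  rw [← lintegral_selectLaw (measurable_one.indicator hs), lintegral_indicator_one hs]

/-- The hypotheses form the induction invariant: `u` agrees with the trajectory up to `j`, there was
no earlier exit, and an exit occurs within the next `k` iterations. The first exit met by the
recursion is therefore `lastIter`. -/
lemma pathValue_eq (ω : ℕ → ℝ × E d) (k j : ℕ) (u : ℕ → E d)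
    (hu : ∀ t ≤ j, u t = (agdState P f S w₀ ω t).1)
    (hns : ∀ t < j, ¬ P.ρ / 2 < (agdState P f S w₀ ω (t + 1)).2)
    (hex : ∃ t, j ≤ t ∧ t < j + k ∧ P.ρ / 2 < (agdState P f S w₀ ω (t + 1)).2) :
    pathValue P f S φ k j u (agdState P f S w₀ ω j).2 (fun i => ω (j + i)) =
      selectValue P f S φ (lastIter P f S w₀ ω) fun t => (agdState P f S w₀ ω t).1 := by
  induction k generalizing j u with
  | zero => obtain ⟨t, h1, h2, _⟩ := hex; omega
  | succ k ih =>
    have hst : agdStep P f S (u j, (agdState P f S w₀ ω j).2) (ω (j + 0)) =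
        agdState P f S w₀ ω (j + 1) := by
      rw [hu j le_rfl]; rfl
    simp only [pathValue]
    rw [hst]
    split_ifs with h
    · have hl : lastIter P f S w₀ ω = j := by
        refine le_antisymm (Nat.sInf_le h) (le_csInf ⟨j, h⟩ fun t ht => ?_)
        by_contra hlt
        exact hns t (not_le.1 hlt) ht
      rw [hl]
      exact selectValue_congr hu
    · have h1 := ih (j + 1) (Function.update u (j + 1) (agdState P f S w₀ ω (j + 1)).1) ?_ ?_ ?_
      · rw [← h1]
        congr 1
        funext i
        congr 1
        ring
      · intro t ht
        rcases Nat.lt_or_ge t (j + 1) with h2 | h2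
        · rw [Function.update_of_ne (by omega)]
          exact hu t (by omega)
        · have : t = j + 1 := by omega
          subst this; simp
      · intro t ht
        rcases Nat.lt_or_ge t j with h2 | h2
        · exact hns t h2
        · have : t = j := by omega
          subst this; exact h
      · obtain ⟨t, h2, h3, h4⟩ := hex
        refine ⟨t, ?_, by omega, h4⟩
        rcases Nat.eq_or_lt_of_le h2 with h5 | h5
        · subst h5; exact absurd h4 h
        · exact h5

lemma agdState_spent_ge (hd : 0 < d) (hn : 0 < n) (hρ : 0 < P.ρ) (hΛ : 0 < logFactor P n)
    (ω : ℕ → ℝ × E d) (t : ℕ) : t * (√P.ρ / n) ≤ (agdState P f S w₀ ω t).2 := by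
  induction t with
  | zero => simp [agdState]
  | succ t ih =>
    have h := privacyCost_ge hd hn hρ hΛ
      (noisyNorm P f S (agdState P f S w₀ ω t).1 (ω t).1)
    simp only [agdState, agdStep]
    push_cast
    linarith

/-- The flat charge `√ρ / n` forces termination on every path, not merely almost surely. -/
lemma exists_spent_gt (hd : 0 < d) (hn : 0 < n) (hρ : 0 < P.ρ) (hΛ : 0 < logFactor P n)
    (ω : ℕ → ℝ × E d) : ∃ t, P.ρ / 2 < (agdState P f S w₀ ω (t + 1)).2 := by
  have hc : 0 < √P.ρ / n := by positivity
  obtain ⟨k, hk⟩ := exists_lt_nsmul hc (P.ρ / 2)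
  refine ⟨k, lt_of_lt_of_le hk ?_⟩
  refine le_trans ?_ (agdState_spent_ge hd hn hρ hΛ ω (k + 1))
  rw [nsmul_eq_mul]
  gcongr
  simp

/-- The expectation of `φ` under the algorithm is computed by the recursion `runValue`. -/
lemma lintegral_algorithmLaw (hd : 0 < d) (hn : 0 < n) (hρ : 0 < P.ρ) (hΛ : 0 < logFactor P n)
    (hg : Measurable (averageGradient f S))
    (hge : Measurable fun w => gradient (empiricalRisk f S) w) (hφ : Measurable φ)
    {K : ℕ} (hK : P.ρ / 2 < K * (√P.ρ / n)) :
    ∫⁻ o, φ o ∂algorithmLaw P f w₀ S = runValue P f S φ K 0 (fun _ => w₀) 0 := by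
  have hexit := exists_spent_gt (f := f) (S := S) (w₀ := w₀) hd hn hρ hΛ
  unfold algorithmLaw
  rw [Measure.lintegral_bind (measurable_selectLaw hexit hg hge).aemeasurable hφ.aemeasurable,
    ← lintegral_pathValue hg hge hφ]
  refine lintegral_congr fun ω => ?_
  rw [lintegral_selectLaw hφ _ fun t => (agdState P f S w₀ ω t).1]
  have h := pathValue_eq (P := P) (f := f) (S := S) (φ := φ) (w₀ := w₀) ω K 0 (fun _ => w₀)
    (fun t ht => by rw [Nat.le_zero.1 ht]; rfl) (fun t ht => by omega) ?_
  · rw [← h]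
    simp only [Nat.zero_add]
    rfl
  · obtain ⟨K, rfl⟩ : ∃ k, K = k + 1 := by
      refine Nat.exists_eq_succ_of_ne_zero fun h => ?_
      subst h
      simp only [Nat.cast_zero, zero_mul] at hK
      linarith
    exact ⟨K, by omega, by omega, hK.trans_le (agdState_spent_ge hd hn hρ hΛ ω (K + 1))⟩

lemma isProbabilityMeasure_algorithmLaw (hd : 0 < d) (hn : 0 < n) (hρ : 0 < P.ρ)
    (hΛ : 0 < logFactor P n) (hg : Measurable (averageGradient f S))
    (hge : Measurable fun w => gradient (empiricalRisk f S) w) :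
    IsProbabilityMeasure (algorithmLaw P f w₀ S) := by
  have hexit := exists_spent_gt (f := f) (S := S) (w₀ := w₀) hd hn hρ hΛ
  refine ⟨?_⟩
  rw [← lintegral_one]
  unfold algorithmLaw
  rw [Measure.lintegral_bind (measurable_selectLaw hexit hg hge).aemeasurable
    measurable_const.aemeasurable]
  have : ∀ ω, ∫⁻ _, 1 ∂selectLaw P f S (lastIter P f S w₀ ω)
      (fun t => (agdState P f S w₀ ω t).1) = 1 := fun ω => by
    rw [lintegral_selectLaw measurable_const _ fun t => (agdState P f S w₀ ω t).1,
      selectValue_one]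
  simp only [this, lintegral_one, measure_univ]

end Law

/-! ### Privacy: composition along the adaptive budget. -/

section Privacy

variable {d n : ℕ} {X : Type*} {P : Params} {f : E d → X → ℝ} {S S' : Fin n → X} {w₀ : E d}
  {φ : Transcript d → ℝ≥0∞} {α q : ℝ}

/-- The expectation of `φ` under at most `k + 1` further iterations, given the noisy gradient
norm `N` in the first of them. -/
noncomputable def normValue (P : Params) (f : E d → X → ℝ) (S : Fin n → X)
    (φ : Transcript d → ℝ≥0∞) (k j : ℕ) (u : ℕ → E d) (s N : ℝ) : ℝ≥0∞ :=
  if P.ρ / 2 < s + privacyCost P d n N then selectValue P f S φ j u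
  else ∫⁻ b, runValue P f S φ k (j + 1) (Function.update u (j + 1)
    (u j - (1 / (2 * P.L₁)) • (averageGradient f S (u j) + gradNoiseScale P d n N • b)))
    (s + privacyCost P d n N) ∂stdGaussian (E d)

lemma measurable_gradNoiseScale : Measurable (gradNoiseScale P d n) := by
  unfold gradNoiseScale; fun_prop

lemma measurable_runValue_update (hg : Measurable (averageGradient f S))
    (hge : Measurable fun w => gradient (empiricalRisk f S) w)
    (hφ : Measurable φ) (k j : ℕ) (u : ℕ → E d) (s : ℝ) :
    Measurable fun p : ℝ × E d => runValue P f S φ k (j + 1) (Function.update u (j + 1)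
      (u j - (1 / (2 * P.L₁)) • (averageGradient f S (u j) + gradNoiseScale P d n p.1 • p.2)))
      (s + privacyCost P d n p.1) := by
  have h1 : Measurable fun p : ℝ × E d => gradNoiseScale P d n p.1 :=
    measurable_gradNoiseScale.comp measurable_fst
  have h2 : Measurable fun p : ℝ × E d => privacyCost P d n p.1 :=
    measurable_privacyCost.comp measurable_fst
  exact (measurable_runValue hg hge hφ k (j + 1)).comp (f := fun p : ℝ × E d =>
      (Function.update u (j + 1) (u j - (1 / (2 * P.L₁)) •
        (averageGradient f S (u j) + gradNoiseScale P d n p.1 • p.2)), s + privacyCost P d n p.1))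
    ((measurable_update_const measurable_const (by fun_prop) _).prodMk (by fun_prop))

lemma measurable_normValue (hg : Measurable (averageGradient f S))
    (hge : Measurable fun w => gradient (empiricalRisk f S) w)
    (hφ : Measurable φ) (k j : ℕ) (u : ℕ → E d) (s : ℝ) :
    Measurable (normValue P f S φ k j u s) := by
  unfold normValue
  have h2 := measurable_privacyCost (P := P) (d := d) (n := n)
  refine Measurable.ite (measurableSet_lt measurable_const (by fun_prop)) measurable_const ?_
  exact Measurable.lintegral_prod_right' (ν := stdGaussian (E d))
    (measurable_runValue_update hg hge hφ k j u s)

lemma runValue_succ (hg : Measurable (averageGradient f S))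
    (hge : Measurable fun w => gradient (empiricalRisk f S) w)
    (hφ : Measurable φ) (k j : ℕ) (u : ℕ → E d) (s : ℝ) :
    runValue P f S φ (k + 1) j u s =
      ∫⁻ z, normValue P f S φ k j u s (noisyNorm P f S (u j) z) ∂gaussianReal 0 1 := by
  have hN : Measurable fun p : ℝ × E d => noisyNorm P f S (u j) p.1 := by
    unfold noisyNorm; fun_prop
  have h2 := (measurable_privacyCost (P := P) (d := d) (n := n)).comp hN
  simp only [Function.comp_def] at h2
  simp only [runValue]
  rw [lintegral_prod]
  · refine lintegral_congr fun z => ?_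
    unfold normValue
    split_ifs with h
    · refine (lintegral_congr fun b => if_pos h).trans ?_
      rw [lintegral_const, measure_univ, mul_one]
    · exact lintegral_congr fun b => if_neg h
  · refine Measurable.aemeasurable ?_
    refine Measurable.ite (measurableSet_lt measurable_const (by fun_prop)) measurable_const ?_
    exact (measurable_runValue_update hg hge hφ k j u s).comp
      (f := fun p : ℝ × E d => (noisyNorm P f S (u j) p.1, p.2)) (hN.prodMk measurable_snd)

/-- Gradient norms change by at most `2 L₀ / n`, so the exponents in the weights change by at most
`√ρ`; the exponential mechanism then costs `(√ρ) ^ 2 / 2`. -/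
lemma selectValue_le_of_neighbors (hL : 0 < P.L₀) (hn : 0 < n) (hρ : 0 < P.ρ)
    (hlip : IsLipschitzLoss f P.L₀) (hsm : IsSmoothLoss f P.L₁) (hS : Neighbors S S')
    (hq : α.HolderConjugate q) (j : ℕ) (u : ℕ → E d) :
    selectValue P f S φ j u ≤ ENNReal.ofReal (Real.exp ((α - 1) * (P.ρ / 2))) *
      selectValue P f S' (fun o => φ o ^ q) j u ^ (1 / q) := by
  have hn' : (0 : ℝ) < n := by exact_mod_cast hn
  have hsq : 0 < √P.ρ := Real.sqrt_pos.2 hρ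
  have h := sum_exp_div_mul_le (ι := Fin (j + 1)) (ε := √P.ρ)
    (x := fun t => -(n * √P.ρ / (2 * P.L₀)) * ‖gradient (empiricalRisk f S) (u t)‖)
    (y := fun t => -(n * √P.ρ / (2 * P.L₀)) * ‖gradient (empiricalRisk f S') (u t)‖)
    (fun t => by
      rw [gradient_empiricalRisk hsm, gradient_empiricalRisk hsm, ← mul_sub, abs_mul, abs_neg,
        abs_of_pos (by positivity)]
      calc n * √P.ρ / (2 * P.L₀) * |‖averageGradient f S (u t)‖ - ‖averageGradient f S' (u t)‖|
          ≤ n * √P.ρ / (2 * P.L₀) * (2 * P.L₀ / n) := by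
            gcongr
            exact (abs_norm_sub_norm_le _ _).trans
              (norm_averageGradient_sub_le_of_neighbors hL hlip hS _)
        _ = √P.ρ := by field_simp)
    (fun t => φ ⟨j, fun t => u t, t⟩) hq
  rw [Real.sq_sqrt hρ.le] at h
  exact h

lemma gradNoiseScale_pos (hL : 0 < P.L₀) (hn : 0 < n) (hρ : 0 < P.ρ) (N : ℝ) :
    0 < gradNoiseScale P d n N := by
  have : 0 < 2 * P.L₀ / (n * √P.ρ) := by
    have : 0 < √P.ρ := Real.sqrt_pos.2 hρ
    positivity
  exact this.trans_le (le_max_right _ _)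

/-- The two terms of the maximum in `σ_t` match those of the minimum in `ρ_t`: the adaptive level
yields the bound depending on `N`, and the floor yields the cap. -/
lemma sensitivity_sq_div_gradNoiseScale_le (hL : 0 < P.L₀) (hd : 0 < d) (hn : 0 < n)
    (hρ : 0 < P.ρ) (hΛ : 0 < logFactor P n) (N : ℝ) :
    (2 * P.L₀ / n / gradNoiseScale P d n N) ^ 2 / 2 ≤
      2 * (privacyCost P d n N - √P.ρ / n) := by
  have hσ := gradNoiseScale_pos (d := d) hL hn hρ N
  have hsq : 0 < √P.ρ := Real.sqrt_pos.2 hρ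
  have hn' : (0 : ℝ) < n := by exact_mod_cast hn
  have hd' : (0 : ℝ) < d := by exact_mod_cast hd
  have h1 : (2 * P.L₀ / n / gradNoiseScale P d n N) ^ 2 / 2 ≤ P.ρ / 2 := by
    have h : 2 * P.L₀ / n / gradNoiseScale P d n N ≤ √P.ρ := by
      rw [div_le_iff₀ hσ]
      calc 2 * P.L₀ / n = √P.ρ * (2 * P.L₀ / (n * √P.ρ)) := by field_simp
        _ ≤ _ := by gcongr; exact le_max_right _ _
    have := pow_le_pow_left₀ (by positivity) h 2
    rw [Real.sq_sqrt hρ.le] at this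
    linarith
  unfold privacyCost
  rw [add_sub_cancel_right]
  split_ifs with hN
  · rw [mul_min_of_nonneg _ _ zero_le_two]
    refine le_min ?_ (by linarith)
    have h : 2 * P.L₀ / n / gradNoiseScale P d n N ≤ 2 * P.L₀ * √(d * logFactor P n) / (n * N) := by
      rw [div_le_iff₀ hσ]
      have : 0 < √(d * logFactor P n) := Real.sqrt_pos.2 (by positivity)
      calc 2 * P.L₀ / n =
          2 * P.L₀ * √(d * logFactor P n) / (n * N) * (N / √(d * logFactor P n)) := by field_simp
        _ ≤ _ := by gcongr; exact le_max_left _ _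
    have h2 := pow_le_pow_left₀ (by positivity) h 2
    rw [div_pow _ (n * N), mul_pow _ √(d * logFactor P n), Real.sq_sqrt (by positivity)] at h2
    calc _ ≤ (2 * P.L₀) ^ 2 * (d * logFactor P n) / (n * N) ^ 2 / 2 := by linarith
      _ = _ := by field_simp
  · linarith

/-- The noise on the norm is calibrated so that its loss is exactly twice the flat charge. -/
lemma sensitivity_sq_div_normNoiseScale (hL : 0 < P.L₀) (hn : 0 < n) (hρ : 0 < P.ρ) :
    (2 * P.L₀ / n / normNoiseScale P n) ^ 2 / 2 = 2 * (√P.ρ / n) := by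
  have hn' : (0 : ℝ) < n := by exact_mod_cast hn
  have h4 : (P.ρ ^ (1 / 4 : ℝ)) ^ 2 = √P.ρ := by
    rw [← Real.rpow_natCast, ← Real.rpow_mul hρ.le, Real.sqrt_eq_rpow]; norm_num
  have h5 : 0 < P.ρ ^ (1 / 4 : ℝ) := by positivity
  unfold normNoiseScale
  have : 2 * P.L₀ / n / (P.L₀ / (√n * P.ρ ^ (1 / 4 : ℝ))) =
      2 * (√n * P.ρ ^ (1 / 4 : ℝ)) / n := by field_simp
  rw [this, div_pow, mul_pow, mul_pow, h4, Real.sq_sqrt hn'.le]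
  field_simp

lemma measurable_averageGradient (hn : 0 < n) (hsm : IsSmoothLoss f P.L₁) (S : Fin n → X) :
    Measurable (averageGradient f S) :=
  (continuous_averageGradient hn hsm S).measurable

lemma measurable_gradient_empiricalRisk (hn : 0 < n) (hsm : IsSmoothLoss f P.L₁)
    (S : Fin n → X) : Measurable fun w => gradient (empiricalRisk f S) w := by
  simp only [gradient_empiricalRisk hsm]
  exact measurable_averageGradient hn hsm S

lemma ofReal_exp_mul_ofReal_exp (a b : ℝ) :
    ENNReal.ofReal (Real.exp a) * ENNReal.ofReal (Real.exp b) =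
      ENNReal.ofReal (Real.exp (a + b)) := by
  rw [← ENNReal.ofReal_mul (Real.exp_pos _).le, Real.exp_add]

/-- Changing expectations by adding `v` to a standard Gaussian and then by a factor `exp (c)`. -/
lemma lintegral_stdGaussian_le_of_le_shift {V : Type*} [NormedAddCommGroup V]
    [InnerProductSpace ℝ V] [FiniteDimensional ℝ V] [MeasurableSpace V] [BorelSpace V]
    {F G : V → ℝ≥0∞} (hG : Measurable G) (v : V) {a B : ℝ} (hq : α.HolderConjugate q)
    (hv : ‖v‖ ^ 2 / 2 + a ≤ B)
    (h : ∀ x, F x ≤ ENNReal.ofReal (Real.exp ((α - 1) * a)) * G (x + v) ^ (1 / q)) :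
    ∫⁻ x, F x ∂stdGaussian V ≤ ENNReal.ofReal (Real.exp ((α - 1) * B)) *
      (∫⁻ x, G x ∂stdGaussian V) ^ (1 / q) := by
  have hα1 : 0 < α - 1 := hq.sub_one_pos
  have hq0 : 0 < q := hq.symm.pos
  have hpow : ∀ x : ℝ≥0∞, (x ^ (1 / q)) ^ q = x := fun x => by
    rw [← ENNReal.rpow_mul, one_div_mul_cancel hq0.ne', ENNReal.rpow_one]
  have h1 := lintegral_stdGaussian_add_le (hG.pow_const (1 / q)) v hq
  simp only [hpow] at h1
  refine (lintegral_mono h).trans ?_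
  rw [lintegral_const_mul' _ _ ENNReal.ofReal_ne_top]
  refine (mul_le_mul_right h1 _).trans ?_
  rw [← mul_assoc, ofReal_exp_mul_ofReal_exp, ← mul_add]
  gcongr
  linarith

/-- Once `N` is fixed, noise level, cost and exit decision are the same for both datasets. On exit
only the selection is left; otherwise the averaged gradients differ by a translation of the Gaussian
noise, and `ih` accounts for the rest. -/
lemma normValue_le_of_neighbors (hL : 0 < P.L₀) (hd : 0 < d) (hn : 0 < n) (hρ : 0 < P.ρ)
    (hΛ : 0 < logFactor P n)
    (hlip : IsLipschitzLoss f P.L₀) (hsm : IsSmoothLoss f P.L₁) (hS : Neighbors S S')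
    (hq : α.HolderConjugate q) (hφ : Measurable φ) (k j : ℕ) (u : ℕ → E d) (s : ℝ)
    (hs : s + √P.ρ / n ≤ P.ρ / 2)
    (ih : ∀ (u : ℕ → E d) (s : ℝ), s ≤ P.ρ / 2 →
      runValue P f S φ k (j + 1) u s ≤
        ENNReal.ofReal (Real.exp ((α - 1) * (3 * P.ρ / 2 - 2 * s))) *
          runValue P f S' (fun o => φ o ^ q) k (j + 1) u s ^ (1 / q)) (N : ℝ) :
    normValue P f S φ k j u s N ≤
      ENNReal.ofReal (Real.exp ((α - 1) * (3 * P.ρ / 2 - 2 * s - 2 * (√P.ρ / n)))) *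
        normValue P f S' (fun o => φ o ^ q) k j u s N ^ (1 / q) := by
  have hα1 : 0 < α - 1 := hq.sub_one_pos
  have hφq : Measurable fun o => φ o ^ q := by fun_prop
  unfold normValue
  split_ifs with h
  -- By `hs`, at least the loss `ρ / 2` needed for selection is still available.
  · refine (selectValue_le_of_neighbors hL hn hρ hlip hsm hS hq j u).trans ?_
    gcongr
    linarith
  · have hσ := gradNoiseScale_pos (d := d) hL hn hρ N
    have hvn := sensitivity_sq_div_gradNoiseScale_le hL hd hn hρ hΛ N
    set σ := gradNoiseScale P d n N with hσdef
    set c := privacyCost P d n N with hc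
    have hm : Measurable fun b : E d => runValue P f S' (fun o => φ o ^ q) k (j + 1)
        (Function.update u (j + 1)
          (u j - (1 / (2 * P.L₁)) • (averageGradient f S' (u j) + σ • b))) (s + c) :=
      (measurable_runValue_update (measurable_averageGradient hn hsm S')
        (measurable_gradient_empiricalRisk hn hsm S') hφq k j u s).comp
        (f := fun b : E d => (N, b)) (measurable_const.prodMk measurable_id)
    refine lintegral_stdGaussian_le_of_le_shift hm
      (σ⁻¹ • (averageGradient f S (u j) - averageGradient f S' (u j)))
      (a := 3 * P.ρ / 2 - 2 * (s + c)) hq ?_ fun b => ?_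
    · rw [norm_smul, norm_inv, Real.norm_of_nonneg hσ.le, inv_mul_eq_div]
      have h2 : (‖averageGradient f S (u j) - averageGradient f S' (u j)‖ / σ) ^ 2 / 2 ≤
          (2 * P.L₀ / n / σ) ^ 2 / 2 := by
        gcongr
        exact norm_averageGradient_sub_le_of_neighbors hL hlip hS _
      linarith
    · have hshift : averageGradient f S' (u j) + σ • (b +
          σ⁻¹ • (averageGradient f S (u j) - averageGradient f S' (u j))) =
          averageGradient f S (u j) + σ • b := by
        rw [smul_add, smul_smul, mul_inv_cancel₀ hσ.ne', one_smul]
        abel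
      rw [hshift]
      exact ih _ (s + c) (not_lt.1 h)

/-- The privacy loss of the remaining iterations is controlled by the remaining budget. -/
lemma runValue_le_of_neighbors (hL : 0 < P.L₀) (hd : 0 < d) (hn : 0 < n) (hρ : 0 < P.ρ)
    (hΛ : 0 < logFactor P n)
    (hlip : IsLipschitzLoss f P.L₀) (hsm : IsSmoothLoss f P.L₁) (hS : Neighbors S S')
    (hq : α.HolderConjugate q) (hφ : Measurable φ) (k j : ℕ) (u : ℕ → E d) (s : ℝ)
    (hs : s ≤ P.ρ / 2) :
    runValue P f S φ k j u s ≤ ENNReal.ofReal (Real.exp ((α - 1) * (3 * P.ρ / 2 - 2 * s))) *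
      runValue P f S' (fun o => φ o ^ q) k j u s ^ (1 / q) := by
  have hα1 : 0 < α - 1 := hq.sub_one_pos
  have hg := measurable_averageGradient (P := P) hn hsm
  have hge := measurable_gradient_empiricalRisk (P := P) hn hsm
  have hφq : Measurable fun o => φ o ^ q := by fun_prop
  induction k generalizing j u s with
  | zero => simp [runValue]
  | succ k ih =>
    rw [runValue_succ (hg S) (hge S) hφ, runValue_succ (hg S') (hge S') hφq]
    -- If the flat charge alone exhausts the budget, exit is certain and `N` has no influence, so
    -- its noise need not be charged. Otherwise the loss `2√ρ/n` of the norm still fits.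
    by_cases hcase : P.ρ / 2 < s + √P.ρ / n
    · have hexit : ∀ N, P.ρ / 2 < s + privacyCost P d n N := fun N => by
        linarith [privacyCost_ge hd hn hρ hΛ N]
      simp only [normValue, hexit, if_true, lintegral_const, measure_univ, mul_one]
      refine (selectValue_le_of_neighbors hL hn hρ hlip hsm hS hq j u).trans ?_
      gcongr
      linarith
    have hn' : (0 : ℝ) < n := by exact_mod_cast hn
    have hτ : 0 < normNoiseScale P n := by unfold normNoiseScale; positivity
    have hm : Measurable fun z : ℝ =>
        normValue P f S' (fun o => φ o ^ q) k j u s (noisyNorm P f S' (u j) z) :=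
      (measurable_normValue (hg S') (hge S') hφq k j u s).comp (by unfold noisyNorm; fun_prop)
    have hshift : ∀ z : ℝ, noisyNorm P f S' (u j)
        (z + (‖averageGradient f S (u j)‖ - ‖averageGradient f S' (u j)‖) /
          normNoiseScale P n) = noisyNorm P f S (u j) z := by
      intro z
      unfold noisyNorm
      field_simp
      ring
    rw [gaussianReal_eq_stdGaussian]
    refine lintegral_stdGaussian_le_of_le_shift hm
      ((‖averageGradient f S (u j)‖ - ‖averageGradient f S' (u j)‖) / normNoiseScale P n)
      (a := 3 * P.ρ / 2 - 2 * s - 2 * (√P.ρ / n)) hq ?_ fun z => ?_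
    · have h2 : ‖(‖averageGradient f S (u j)‖ - ‖averageGradient f S' (u j)‖) /
          normNoiseScale P n‖ ^ 2 / 2 ≤ 2 * (√P.ρ / n) := by
        rw [← sensitivity_sq_div_normNoiseScale hL hn hρ, norm_div, Real.norm_of_nonneg hτ.le,
          Real.norm_eq_abs]
        gcongr
        exact (abs_norm_sub_norm_le _ _).trans
          (norm_averageGradient_sub_le_of_neighbors hL hlip hS _)
      linarith
    · rw [hshift]
      exact normValue_le_of_neighbors hL hd hn hρ hΛ hlip hsm hS hq hφ k j u s
        (not_lt.1 hcase) (fun u s hs => ih (j + 1) u s hs) _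

lemma exists_lt_nat_mul_cost (hn : 0 < n) (hρ : 0 < P.ρ) :
    ∃ K : ℕ, P.ρ / 2 < K * (√P.ρ / n) := by
  have hc : 0 < √P.ρ / n := by positivity
  obtain ⟨k, hk⟩ := exists_lt_nsmul hc (P.ρ / 2)
  exact ⟨k, by rwa [nsmul_eq_mul] at hk⟩

lemma lintegral_algorithmLaw_le_of_neighbors (hL : 0 < P.L₀) (hd : 0 < d) (hn : 0 < n)
    (hρ : 0 < P.ρ) (hΛ : 0 < logFactor P n)
    (hlip : IsLipschitzLoss f P.L₀) (hsm : IsSmoothLoss f P.L₁) (hS : Neighbors S S')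
    (hq : α.HolderConjugate q) (hφ : Measurable φ) :
    ∫⁻ o, φ o ∂algorithmLaw P f w₀ S ≤
      ENNReal.ofReal (Real.exp ((α - 1) * (2 * P.ρ))) *
        (∫⁻ o, φ o ^ q ∂algorithmLaw P f w₀ S') ^ (1 / q) := by
  have hα1 : 0 < α - 1 := hq.sub_one_pos
  have hg := measurable_averageGradient (P := P) hn hsm
  have hge := measurable_gradient_empiricalRisk (P := P) hn hsm
  obtain ⟨K, hK⟩ := exists_lt_nat_mul_cost (P := P) hn hρ
  rw [lintegral_algorithmLaw hd hn hρ hΛ (hg S) (hge S) hφ hK,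
    lintegral_algorithmLaw hd hn hρ hΛ (hg S') (hge S') (by fun_prop) hK]
  refine (runValue_le_of_neighbors hL hd hn hρ hΛ hlip hsm hS hq hφ K 0 (fun _ => w₀) 0
    (by positivity)).trans ?_
  gcongr
  linarith

lemma measurable_selected : Measurable (Transcript.selected (d := d)) := by
  intro s hs
  refine MeasurableSpace.measurableSet_iInf.2 fun T => ?_
  have : Measurable fun p : (Fin (T + 1) → E d) × Fin (T + 1) => p.1 p.2 :=
    measurable_from_prod_countable_left fun t => measurable_pi_apply t
  exact this hs

theorem isZCDP_algorithmLaw (hL : 0 < P.L₀) (hd : 0 < d) (hn : 0 < n)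
    (hρ : 0 < P.ρ) (hΛ : 0 < logFactor P n)
    (hlip : IsLipschitzLoss f P.L₀) (hsm : IsSmoothLoss f P.L₁) (w₀ : E d) :
    IsZCDP (fun S : Fin n → X => algorithmLaw P f w₀ S) (2 * P.ρ) ∧
      IsZCDP (fun S : Fin n → X => (algorithmLaw P f w₀ S).map Transcript.selected)
        (2 * P.ρ) := by
  have hg := measurable_averageGradient (P := P) hn hsm
  have hge := measurable_gradient_empiricalRisk (P := P) hn hsm
  have hprob : ∀ S : Fin n → X, IsProbabilityMeasure (algorithmLaw P f w₀ S) := fun S =>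
    isProbabilityMeasure_algorithmLaw hd hn hρ hΛ (hg S) (hge S)
  have hprob' : ∀ S : Fin n → X,
      IsProbabilityMeasure ((algorithmLaw P f w₀ S).map Transcript.selected) := fun S =>
    Measure.isProbabilityMeasure_map measurable_selected.aemeasurable
  refine ⟨⟨hprob, fun S S' hS α hα => ?_⟩, ⟨hprob', fun S S' hS α hα => ?_⟩⟩
  · rw [mul_comm]
    exact renyiDivergence_le_of_dual (Real.HolderConjugate.conjExponent hα) fun φ hφ =>
      lintegral_algorithmLaw_le_of_neighbors hL hd hn hρ hΛ hlip hsm hS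
        (Real.HolderConjugate.conjExponent hα) hφ
  · rw [mul_comm]
    refine renyiDivergence_le_of_dual (Real.HolderConjugate.conjExponent hα) fun φ hφ => ?_
    -- Post-processing in dual form: the transcript bound is applied to the test function `φ ∘
    -- Transcript.selected`.
    rw [lintegral_map hφ measurable_selected, lintegral_map (by fun_prop) measurable_selected]
    exact lintegral_algorithmLaw_le_of_neighbors hL hd hn hρ hΛ hlip hsm hS
      (Real.HolderConjugate.conjExponent hα) (hφ.comp measurable_selected)

end Privacy

/-! ### Descent inequalities for smooth functions. -/

section Descent

open scoped RealInnerProductSpace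

variable {H : Type*} [NormedAddCommGroup H] [InnerProductSpace ℝ H] [CompleteSpace H]

/-- The descent lemma for functions with Lipschitz gradient. -/
lemma le_add_inner_add_sq_of_lipschitz_gradient {F : H → ℝ} {g : H → H} {L : ℝ}
    (hF : ∀ w, HasGradientAt F (g w) w) (hg : ∀ w v, ‖g w - g v‖ ≤ L * ‖w - v‖) (w x : H) :
    F (w + x) ≤ F w + ⟪g w, x⟫ + L / 2 * ‖x‖ ^ 2 := by
  -- The difference from the quadratic model along the segment; the Lipschitz gradient makes its
  -- derivative nonpositive, and comparing `t = 0` with `t = 1` gives the claim.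
  let h : ℝ → ℝ := fun t => F (w + t • x) - t * ⟪g w, x⟫ - L / 2 * ‖x‖ ^ 2 * t ^ 2
  have hd : ∀ t, HasDerivAt h (⟪g (w + t • x), x⟫ - ⟪g w, x⟫ - L / 2 * ‖x‖ ^ 2 * (2 * t)) t := by
    intro t
    have h1 : HasDerivAt (fun t : ℝ => w + t • x) x t := by
      simpa using ((hasDerivAt_id t).smul_const x).const_add w
    have h2 : HasDerivAt (fun t : ℝ => F (w + t • x)) ⟪g (w + t • x), x⟫ t := by
      have h := (hF (w + t • x)).hasFDerivAt.comp_hasDerivAt t h1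
      rwa [InnerProductSpace.toDual_apply_apply] at h
    have h3 : HasDerivAt (fun t : ℝ => t * ⟪g w, x⟫) ⟪g w, x⟫ t := by
      simpa using (hasDerivAt_id t).mul_const ⟪g w, x⟫
    have h4 : HasDerivAt (fun t : ℝ => L / 2 * ‖x‖ ^ 2 * t ^ 2) (L / 2 * ‖x‖ ^ 2 * (2 * t)) t := by
      simpa using (hasDerivAt_pow 2 t).const_mul (L / 2 * ‖x‖ ^ 2)
    exact (h2.sub h3).sub h4
  have hanti : AntitoneOn h (Set.Icc 0 1) := by
    refine antitoneOn_of_deriv_nonpos (convex_Icc 0 1)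
      (fun t _ => (hd t).continuousAt.continuousWithinAt)
      (fun t _ => (hd t).differentiableAt.differentiableWithinAt) fun t ht => ?_
    rw [interior_Icc] at ht
    rw [(hd t).deriv, ← inner_sub_left]
    have h1 : ⟪g (w + t • x) - g w, x⟫ ≤ L * ‖t • x‖ * ‖x‖ := by
      refine (real_inner_le_norm _ _).trans ?_
      gcongr
      simpa using hg (w + t • x) w
    rw [norm_smul, Real.norm_of_nonneg ht.1.le] at h1
    nlinarith
  have h01 := hanti (Set.left_mem_Icc.2 zero_le_one) (Set.right_mem_Icc.2 zero_le_one) zero_le_one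
  simp only [h, one_smul, zero_smul, add_zero, one_mul, zero_mul, one_pow, mul_one, sub_zero,
    ne_eq, OfNat.ofNat_ne_zero, not_false_eq_true, zero_pow, mul_zero] at h01
  linarith

/-- A gradient step of size `1 / L` decreases `F` by at least `‖g w‖ ^ 2 / (2 * L)`, and cannot go
below the minimum. -/
lemma sq_norm_gradient_le_of_lipschitz_gradient {F : H → ℝ} {g : H → H} {L : ℝ} (hL : 0 < L)
    (hF : ∀ w, HasGradientAt F (g w) w) (hg : ∀ w v, ‖g w - g v‖ ≤ L * ‖w - v‖)
    {wstar : H} (hmin : ∀ w, F wstar ≤ F w) (w : H) :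
    ‖g w‖ ^ 2 ≤ 2 * (L * (F w - F wstar)) := by
  have h := le_add_inner_add_sq_of_lipschitz_gradient hF hg w (-(1 / L) • g w)
  rw [inner_smul_right, real_inner_self_eq_norm_sq, norm_smul, norm_neg, mul_pow,
    Real.norm_of_nonneg (by positivity)] at h
  have h2 := hmin (w + -(1 / L) • g w)
  have h3 : F wstar ≤ F w - 1 / (2 * L) * ‖g w‖ ^ 2 := by
    refine (h2.trans h).trans (le_of_eq ?_)
    field_simp
    ring
  have h4 : 1 / (2 * L) * ‖g w‖ ^ 2 ≤ F w - F wstar := by linarith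
  rw [one_div, inv_mul_le_iff₀ (by positivity)] at h4
  linarith

/-- One noisy gradient step with step size `1 / (2 L)`. -/
lemma noisy_step_le {F : H → ℝ} {g : H → H} {L : ℝ} (hL : 0 < L)
    (hF : ∀ w, HasGradientAt F (g w) w) (hg : ∀ w v, ‖g w - g v‖ ≤ L * ‖w - v‖) (w b : H) :
    L * F (w - (1 / (2 * L)) • (g w + b)) ≤
      L * F w - 3 / 8 * ‖g w‖ ^ 2 - 1 / 4 * ⟪g w, b⟫ + 1 / 8 * ‖b‖ ^ 2 := by
  have h := le_add_inner_add_sq_of_lipschitz_gradient hF hg w (-((1 / (2 * L)) • (g w + b)))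
  rw [← sub_eq_add_neg, inner_neg_right, norm_neg, inner_smul_right, norm_smul, mul_pow,
    inner_add_right, real_inner_self_eq_norm_sq, Real.norm_of_nonneg (by positivity),
    norm_add_sq_real] at h
  refine (mul_le_mul_of_nonneg_left h hL.le).trans (le_of_eq ?_)
  field_simp
  ring

end Descent

/-! ### Exponential moments of one noisy step. -/

section Moment

open scoped RealInnerProductSpace
open Module

variable {V : Type*} [NormedAddCommGroup V] [InnerProductSpace ℝ V] [FiniteDimensional ℝ V]
  [MeasurableSpace V] [BorelSpace V]

lemma one_sub_rpow_neg_le {y r : ℝ} (hy0 : 0 ≤ y) (hy : y ≤ 1 / 2) (hr : 0 ≤ r) :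
    (1 - y) ^ (-r) ≤ Real.exp (2 * y * r) := by
  have h0 : 0 < 1 - y := by linarith
  have h1 : (1 - y)⁻¹ ≤ Real.exp (2 * y) := by
    rw [inv_le_comm₀ h0 (Real.exp_pos _), inv_le_iff_one_le_mul₀ (Real.exp_pos _)]
    have := Real.add_one_le_exp (2 * y)
    nlinarith
  rw [Real.rpow_neg h0.le, ← Real.inv_rpow h0.le, Real.exp_mul]
  gcongr

lemma lintegral_exp_inner_add_sq_le (u : V) {s : ℝ} (hs0 : 0 ≤ s) (hs : s ≤ 1 / 4) :
    ∫⁻ x, ENNReal.ofReal (Real.exp (⟪u, x⟫ + s * ‖x‖ ^ 2)) ∂stdGaussian V ≤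
      ENNReal.ofReal (Real.exp (2 * s * finrank ℝ V + ‖u‖ ^ 2)) := by
  rw [lintegral_exp_inner_add_sq_stdGaussian u (by linarith)]
  refine ENNReal.ofReal_le_ofReal ?_
  rw [Real.exp_add]
  gcongr
  · refine (one_sub_rpow_neg_le (by linarith) (by linarith) (by positivity)).trans (le_of_eq ?_)
    ring_nf
  · exact div_le_self (by positivity) (by linarith)

/-- Exponential moment of the relative change of the potential `Q` in one noisy step, where
`σ` is the noise level: the noise is either dominated by the gradient `g`, or by `Q`. -/
lemma lintegral_exp_step_le (hV : 0 < finrank ℝ V) {g : V} {Q Λ σ δ : ℝ} (hQ : 0 < Q)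
    (hgQ : ‖g‖ ^ 2 ≤ 2 * Q) (hΛ : 3 / 2 ≤ Λ)
    (hσ : (finrank ℝ V * Λ * σ ^ 2 ≤ 1.21 * ‖g‖ ^ 2 ∧ 0 ≤ δ) ∨
      (finrank ℝ V * Λ * σ ^ 2 ≤ Q ∧ 1 / 8 ≤ δ)) :
    ∫⁻ b, ENNReal.ofReal (Real.exp (Λ / 2 * ((-(5 / 16) * ‖g‖ ^ 2 - 1 / 4 * ⟪g, σ • b⟫ +
      1 / 8 * ‖σ • b‖ ^ 2) / Q))) ∂stdGaussian V ≤ ENNReal.ofReal (Real.exp δ) := by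
  have hd : (1 : ℝ) ≤ finrank ℝ V := by exact_mod_cast hV
  set D : ℝ := (finrank ℝ V : ℝ) with hD
  set A := ‖g‖ ^ 2 / Q with hA
  have hA0 : 0 ≤ A := by positivity
  have hA2 : A ≤ 2 := by rw [hA, div_le_iff₀ hQ]; exact hgQ
  set B := D * Λ * σ ^ 2 / Q with hB
  have hB0 : 0 ≤ B := by positivity
  have hs : Λ * σ ^ 2 / (16 * Q) = B / (16 * D) := by
    rw [hB]; field_simp
  have hσ' : (B ≤ 1.21 * A ∧ 0 ≤ δ) ∨ (B ≤ 1 ∧ 1 / 8 ≤ δ) := by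
    refine hσ.imp (fun h => ⟨?_, h.2⟩) fun h => ⟨?_, h.2⟩
    · rw [hB, hA, ← mul_div_assoc]; exact div_le_div_of_nonneg_right h.1 hQ.le
    · rw [hB, div_le_one hQ]; exact h.1
  have hB4 : B ≤ 4 := by rcases hσ' with h | h <;> linarith [h.1]
  have e : ∀ b : V, ENNReal.ofReal (Real.exp (Λ / 2 * ((-(5 / 16) * ‖g‖ ^ 2 -
      1 / 4 * ⟪g, σ • b⟫ + 1 / 8 * ‖σ • b‖ ^ 2) / Q))) =
      ENNReal.ofReal (Real.exp (-(5 / 32) * Λ * A)) * ENNReal.ofReal (Real.exp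
        (⟪(-(Λ * σ / (8 * Q))) • g, b⟫ + Λ * σ ^ 2 / (16 * Q) * ‖b‖ ^ 2)) := by
    intro b
    rw [ofReal_exp_mul_ofReal_exp, inner_smul_right, real_inner_smul_left, norm_smul, mul_pow,
      Real.norm_eq_abs, sq_abs, hA]
    congr 2
    field_simp
    ring
  simp_rw [e]
  rw [lintegral_const_mul' _ _ ENNReal.ofReal_ne_top]
  have hs4 : Λ * σ ^ 2 / (16 * Q) ≤ 1 / 4 := by
    rw [hs, div_le_iff₀ (by positivity)]; linarith
  refine (mul_le_mul_right (lintegral_exp_inner_add_sq_le _ (by positivity) hs4) _).trans ?_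
  rw [ofReal_exp_mul_ofReal_exp]
  refine ENNReal.ofReal_le_ofReal (Real.exp_le_exp.2 ?_)
  rw [hs, norm_smul, mul_pow, Real.norm_eq_abs, sq_abs]
  have e1 : 2 * (B / (16 * D)) * D = B / 8 := by field_simp; ring
  have e2 : (-(Λ * σ / (8 * Q))) ^ 2 * ‖g‖ ^ 2 = Λ * A * B / 64 / D := by
    rw [hA, hB]; field_simp; ring
  rw [← hD, e1, e2]
  have h3 : Λ * A * B / 64 / D ≤ Λ * A * B / 64 := div_le_self (by positivity) hd
  have hΛA : 3 / 2 * A ≤ Λ * A := by gcongr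
  have hΛA0 : 0 ≤ Λ * A := by positivity
  -- In the first case `A ≤ 2` and `Λ ≥ 3/2` let the descent term `5/32 * Λ * A` absorb both noise
  -- terms. In the second it absorbs the linear noise, and the remaining `B / 8 ≤ 1/8` is paid by
  -- `δ`.
  rcases hσ' with ⟨h, hδ⟩ | ⟨h, hδ⟩
  · have : Λ * A * B ≤ Λ * A * (1.21 * 2) := by
      gcongr; linarith
    linarith
  · have : Λ * A * B ≤ Λ * A * 1 := by gcongr
    linarith

end Moment

/-! ### From budget exhaustion to the convergence rate. -/

section Rate

variable {d n : ℕ} {P : Params} {Φ₀ : ℝ}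

/-- The error due to the noise on the gradient norm. -/
noncomputable def noiseError (P : Params) (n : ℕ) : ℝ :=
  P.L₀ * √(logFactor P n) / (√n * P.ρ ^ (1 / 4 : ℝ))

/-- The part of the convergence rate that depends on the number `T` of iterations. -/
noncomputable def optimizationError (P : Params) (d n : ℕ) (Φ₀ : ℝ) (T : ℕ) : ℝ :=
  if T = 0 then √(P.L₀ * √(Φ₀ * P.L₁ * d * logFactor P n) / (n * √P.ρ))
    + √(Φ₀ * P.L₁ / (n * √P.ρ))
  else min (√(Φ₀ * P.L₁ / T)) (√(P.L₀ * √(Φ₀ * P.L₁ * d * logFactor P n) / (n * √P.ρ))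
    + √(Φ₀ * P.L₁ / (n * √P.ρ)))

lemma stationarityRate_eq (T : ℕ) : stationarityRate P d n Φ₀ T =
    optimizationError P d n Φ₀ T + noiseError P n := rfl

lemma optimizationError_nonneg (T : ℕ) : 0 ≤ optimizationError P d n Φ₀ T := by
  unfold optimizationError
  split_ifs <;> positivity

lemma le_mul_optimizationError {g c : ℝ} {T : ℕ} (hc : 0 ≤ c)
    (h1 : T ≠ 0 → g ≤ c * √(Φ₀ * P.L₁ / T))
    (h2 : g ≤ c * (√(P.L₀ * √(Φ₀ * P.L₁ * d * logFactor P n) / (n * √P.ρ))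
      + √(Φ₀ * P.L₁ / (n * √P.ρ)))) : g ≤ c * optimizationError P d n Φ₀ T := by
  unfold optimizationError
  split_ifs with h
  · exact h2
  · rw [mul_min_of_nonneg _ _ hc]
    exact le_min (h1 h) h2

lemma sqrt_mul_rpow_quarter (hρ : 0 < P.ρ) : √n * P.ρ ^ (1 / 4 : ℝ) = √(n * √P.ρ) := by
  rw [Real.sqrt_mul (by positivity), Real.sqrt_eq_rpow √P.ρ, Real.sqrt_eq_rpow P.ρ,
    ← Real.rpow_mul hρ.le]
  norm_num

lemma noiseError_eq (hρ : 0 < P.ρ) :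
    noiseError P n = P.L₀ * (√(logFactor P n) / √(n * √P.ρ)) := by
  rw [noiseError, sqrt_mul_rpow_quarter hρ, mul_div_assoc]

lemma noiseError_pos (hn : 0 < n) (hρ : 0 < P.ρ) (hL : 0 < P.L₀) (hΛ : 0 < logFactor P n) :
    0 < noiseError P n := by
  have := Real.sqrt_pos.2 hΛ
  unfold noiseError; positivity

lemma noiseError_eq_mul_normNoiseScale :
    noiseError P n = √(logFactor P n) * normNoiseScale P n := by
  unfold noiseError normNoiseScale; ring

/-- In this regime the rate already exceeds the Lipschitz bound on every gradient, so convergence is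
trivial. -/
lemma le_noiseError_of_lt (hn : 0 < n) (hρ : 0 < P.ρ) (hL : 0 < P.L₀)
    (hΛ : n * √P.ρ ≤ logFactor P n) : P.L₀ ≤ noiseError P n := by
  have hm : 0 < √(n * √P.ρ) := Real.sqrt_pos.2 (by positivity)
  rw [noiseError_eq hρ]
  refine le_mul_of_one_le_right hL.le ?_
  rw [one_le_div hm]
  exact Real.sqrt_le_sqrt hΛ

/-- The selection error is linear in `Λ / (n√ρ)`, which is at most its own square root when that
ratio is at most `1`. -/
lemma mul_logFactor_le_noiseError (hn : 0 < n) (hρ : 0 < P.ρ) (hL : 0 < P.L₀)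
    (hΛ : logFactor P n ≤ n * √P.ρ) (hΛ0 : 0 ≤ logFactor P n) :
    P.L₀ / (n * √P.ρ) * logFactor P n ≤ noiseError P n := by
  have hm0 : 0 < n * √P.ρ := by positivity
  have hm : 0 < √(n * √P.ρ) := Real.sqrt_pos.2 hm0
  rw [noiseError_eq hρ, div_mul_eq_mul_div, mul_div_assoc]
  refine mul_le_mul_of_nonneg_left ?_ hL.le
  have h1 : √(logFactor P n) / √(n * √P.ρ) ≤ 1 := by
    rw [div_le_one hm]; exact Real.sqrt_le_sqrt hΛ
  have h2 : logFactor P n / (n * √P.ρ) = (√(logFactor P n) / √(n * √P.ρ)) ^ 2 := by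
    rw [div_pow, Real.sq_sqrt hΛ0, Real.sq_sqrt hm0.le]
  rw [h2, sq]
  exact mul_le_of_le_one_right (by positivity) h1

lemma le_mul_sqrt_of_sq_le {g c x : ℝ} (hc : 0 ≤ c) (h : g ^ 2 ≤ c ^ 2 * x) : g ≤ c * √x := by
  have : √(c ^ 2 * x) = c * √x := by rw [Real.sqrt_mul (sq_nonneg c), Real.sqrt_sq hc]
  rw [← this]
  exact Real.le_sqrt_of_sq_le h

/-- If the budget is exhausted after the iterations `0, …, T` and the squared gradient norms are
summable with a bound proportional to `Φ₀ L₁`, then the smallest gradient norm is small. -/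
lemma exists_le_mul_optimizationError (hn : 0 < n) (hρ : 0 < P.ρ) (hL : 0 < P.L₀)
    (hL₁ : 0 < P.L₁) (hΛ : 0 < logFactor P n) (hΦ : 0 ≤ Φ₀) {T : ℕ} {G : ℕ → ℝ}
    (hG : ∀ t ≤ T, 0 < G t) {Q : ℝ} (hQ : Q ≤ 500 * (Φ₀ * P.L₁))
    (hsum : ∑ t ∈ Finset.range T, G t ^ 2 ≤ 16 * Q) (hlast : G T ^ 2 ≤ 2 * Q)
    (hcost : P.ρ / 2 < ∑ t ∈ Finset.range (T + 1),
      (P.L₀ ^ 2 * d * logFactor P n / (0.81 * n ^ 2 * G t ^ 2) + √P.ρ / n)) :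
    ∃ t ≤ T, G t ≤ 200 * optimizationError P d n Φ₀ T := by
  obtain ⟨t₀, ht₀, hmin⟩ := Finset.exists_min_image (Finset.range (T + 1)) G ⟨0, by simp⟩
  have ht₀' : t₀ ≤ T := by simpa [Nat.lt_succ_iff] using ht₀
  refine ⟨t₀, ht₀', ?_⟩
  have hg : 0 < G t₀ := hG t₀ ht₀'
  set g := G t₀
  have hn' : (0 : ℝ) < n := by exact_mod_cast hn
  have hsq : 0 < √P.ρ := Real.sqrt_pos.2 hρ
  have hm : 0 < n * √P.ρ := by positivity
  have hss : √P.ρ * √P.ρ = P.ρ := Real.mul_self_sqrt hρ.le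
  set Λ := logFactor P n
  have hgt : ∀ t ∈ Finset.range (T + 1), g ^ 2 ≤ G t ^ 2 := fun t ht => by
    have := hmin t ht
    gcongr
  have hT : T * g ^ 2 ≤ 16 * Q := by
    refine le_trans ?_ hsum
    have := Finset.card_nsmul_le_sum (Finset.range T) (fun t => G t ^ 2) (g ^ 2) fun t ht =>
      hgt t (Finset.mem_range.2 ((Finset.mem_range.1 ht).trans (Nat.lt_succ_self _)))
    simpa using this
  -- The sum in the potential omits the last iterate, whose gradient `hlast` bounds by the gap: `16
  -- + 2 = 18`.
  have hT1 : (T + 1) * g ^ 2 ≤ 18 * Q := by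
    have := hgt T (by simp)
    linarith
  have hc : P.ρ / 2 < (T + 1) * (P.L₀ ^ 2 * d * Λ / (0.81 * n ^ 2 * g ^ 2) + √P.ρ / n) := by
    refine hcost.trans_le ?_
    have := Finset.sum_le_card_nsmul (Finset.range (T + 1))
      (fun t => P.L₀ ^ 2 * d * Λ / (0.81 * n ^ 2 * G t ^ 2) + √P.ρ / n)
      (P.L₀ ^ 2 * d * Λ / (0.81 * n ^ 2 * g ^ 2) + √P.ρ / n) fun t ht => by
        have := hgt t ht
        gcongr
    rw [Finset.card_range, nsmul_eq_mul] at this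
    push_cast at this
    exact this
  refine le_mul_optimizationError (by norm_num) (fun hT0 => ?_) ?_
  · have hT' : (0 : ℝ) < T := by exact_mod_cast Nat.pos_of_ne_zero hT0
    refine le_mul_sqrt_of_sq_le (by norm_num) ?_
    rw [← mul_div_assoc, le_div_iff₀ hT']
    have : 0 ≤ Φ₀ * P.L₁ := by positivity
    linarith
  -- One of the flat and adaptive charges makes up half of the spent `ρ / 2`. In the flat case `T +
  -- 1` exceeds `n√ρ / 4`, and `4 * 18 * 500 ≤ 200 ^ 2`. In the adaptive case, multiplying by `g ^
  -- 2` and using `hT1` bounds `g ^ 4`.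
  · by_cases h : P.ρ / 4 < (T + 1) * (√P.ρ / n)
    · have h1 : n * √P.ρ / 4 < T + 1 := by
        rw [← mul_div_assoc, lt_div_iff₀ hn'] at h
        have : n * √P.ρ / 4 * √P.ρ < (T + 1) * √P.ρ := by
          calc n * √P.ρ / 4 * √P.ρ = √P.ρ * √P.ρ / 4 * n := by ring
            _ = P.ρ / 4 * n := by rw [hss]
            _ < _ := h
        exact lt_of_mul_lt_mul_right this hsq.le
      have h2 : g ≤ 200 * √(Φ₀ * P.L₁ / (n * √P.ρ)) := by
        refine le_mul_sqrt_of_sq_le (by norm_num) ?_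
        rw [← mul_div_assoc, le_div_iff₀ hm]
        have h3 : n * √P.ρ / 4 * g ^ 2 ≤ (T + 1) * g ^ 2 := by gcongr
        have : 0 ≤ Φ₀ * P.L₁ := by positivity
        linarith
      refine h2.trans ?_
      gcongr
      exact le_add_of_nonneg_left (Real.sqrt_nonneg _)
    · have h1 : P.ρ / 4 < (T + 1) * (P.L₀ ^ 2 * d * Λ / (0.81 * n ^ 2 * g ^ 2)) := by
        rw [mul_add] at hc
        linarith
      rw [← mul_div_assoc, lt_div_iff₀ (by positivity)] at h1
      have h2 : (n * √P.ρ) ^ 2 * (g ^ 2) ^ 2 ≤ 44500 * (P.L₀ ^ 2 * (Φ₀ * P.L₁ * d * Λ)) := by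
        have h3 : (T + 1) * (P.L₀ ^ 2 * d * Λ) * g ^ 2 ≤
            9000 * (Φ₀ * P.L₁) * (P.L₀ ^ 2 * d * Λ) := by
          calc (T + 1) * (P.L₀ ^ 2 * d * Λ) * g ^ 2
              = (T + 1) * g ^ 2 * (P.L₀ ^ 2 * d * Λ) := by ring
            _ ≤ _ := mul_le_mul_of_nonneg_right (by linarith) (by positivity)
        have h4 : P.ρ / 4 * (0.81 * n ^ 2 * g ^ 2) * g ^ 2 ≤
            (T + 1) * (P.L₀ ^ 2 * d * Λ) * g ^ 2 := by gcongr
        have h5 : (n * √P.ρ) ^ 2 * (g ^ 2) ^ 2 = P.ρ * n ^ 2 * g ^ 2 * g ^ 2 := by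
          rw [mul_pow, Real.sq_sqrt hρ.le]; ring
        have h6 : 0 ≤ P.L₀ ^ 2 * (Φ₀ * P.L₁ * d * Λ) := by positivity
        rw [h5]
        linarith
      have h3 : n * √P.ρ * g ^ 2 ≤ 40000 * (P.L₀ * √(Φ₀ * P.L₁ * d * Λ)) := by
        refine abs_le_of_sq_le_sq' ?_ (by positivity) |>.2
        rw [mul_pow _ (g ^ 2), mul_pow 40000, mul_pow P.L₀, Real.sq_sqrt (by positivity)]
        have h6 : 0 ≤ P.L₀ ^ 2 * (Φ₀ * P.L₁ * d * Λ) := by positivity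
        linarith
      have h4 : g ≤ 200 * √(P.L₀ * √(Φ₀ * P.L₁ * d * Λ) / (n * √P.ρ)) := by
        refine le_mul_sqrt_of_sq_le (by norm_num) ?_
        rw [← mul_div_assoc, le_div_iff₀ hm]
        linarith
      refine h4.trans ?_
      gcongr
      exact le_add_of_nonneg_right (Real.sqrt_nonneg _)

end Rate

/-! ### Utility of the selection and the violation event. -/

section Select

variable {d n : ℕ} {X : Type*} {P : Params} {f : E d → X → ℝ} {S : Fin n → X} {w₀ : E d}
  {φ : Transcript d → ℝ≥0∞} {Φ₀ : ℝ}

/-- Utility of the exponential mechanism. -/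
lemma selectValue_le_of_exists (hsm : IsSmoothLoss f P.L₁) (hn : 0 < n) (hρ : 0 < P.ρ)
    (hL : 0 < P.L₀) {β c c' : ℝ}
    (hβ : 0 < β) {j : ℕ} {u : ℕ → E d}
    (hφ : ∀ t : Fin (j + 1), φ ⟨j, fun t => u t, t⟩ ≤
      if c' < ‖averageGradient f S (u t)‖ then 1 else 0)
    (hex : ∃ t ≤ j, ‖averageGradient f S (u t)‖ ≤ c)
    (hc : c + 2 * P.L₀ / (n * √P.ρ) * Real.log ((j + 1) / β) ≤ c') :
    selectValue P f S φ j u ≤ ENNReal.ofReal β := by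
  obtain ⟨t₀, hct₀⟩ : ∃ t₀ : Fin (j + 1), ‖averageGradient f S (u t₀)‖ ≤ c := by
    obtain ⟨t₀, ht₀, hct₀⟩ := hex
    exact ⟨⟨t₀, by omega⟩, hct₀⟩
  have hm : 0 < n * √P.ρ := by positivity
  set γ := n * √P.ρ / (2 * P.L₀) with hγ
  have hγ0 : 0 < γ := by positivity
  have hW : 0 < ∑ s : Fin (j + 1), selectWeight P f S (u s) :=
    Finset.sum_pos (fun _ _ => selectWeight_pos _) Finset.univ_nonempty
  have hge : selectWeight P f S (u t₀) ≤ ∑ s : Fin (j + 1), selectWeight P f S (u s) :=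
    Finset.single_le_sum (f := fun s : Fin (j + 1) => selectWeight P f S (u s))
      (fun s _ => (selectWeight_pos _).le) (Finset.mem_univ t₀)
  -- Comparison with the weight of `t₀` alone gives every bad index probability at most `β / (j +
  -- 1)`; there are at most `j + 1` of them.
  have hterm : ∀ t : Fin (j + 1), ENNReal.ofReal (selectWeight P f S (u t) /
      ∑ s : Fin (j + 1), selectWeight P f S (u s)) * φ ⟨j, fun t => u t, t⟩ ≤
      ENNReal.ofReal (β / (j + 1)) := by
    intro t
    refine (mul_le_mul_right (hφ t) _).trans ?_
    split_ifs with h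
    · rw [mul_one]
      refine ENNReal.ofReal_le_ofReal ?_
      calc selectWeight P f S (u t) / ∑ s : Fin (j + 1), selectWeight P f S (u s)
          ≤ selectWeight P f S (u t) / selectWeight P f S (u t₀) := by
            have := selectWeight_pos (P := P) (f := f) (S := S) (u t₀)
            have := selectWeight_pos (P := P) (f := f) (S := S) (u t)
            gcongr
        _ = Real.exp (-γ * (‖averageGradient f S (u t)‖ - ‖averageGradient f S (u t₀)‖)) := by
            simp only [selectWeight, gradient_empiricalRisk hsm]
            rw [← Real.exp_sub]
            congr 1; ring
        _ ≤ Real.exp (-Real.log ((j + 1) / β)) := by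
            refine Real.exp_le_exp.2 ?_
            have h1 : 2 * P.L₀ / (n * √P.ρ) * Real.log ((j + 1) / β) ≤
                ‖averageGradient f S (u t)‖ - ‖averageGradient f S (u t₀)‖ := by linarith
            have h2 := mul_le_mul_of_nonneg_left h1 hγ0.le
            have h3 : γ * (2 * P.L₀ / (n * √P.ρ) * Real.log ((j + 1) / β)) =
                Real.log ((j + 1) / β) := by rw [hγ]; field_simp
            linarith
        _ = β / (j + 1) := by
            rw [Real.exp_neg, Real.exp_log (by positivity), inv_div]
    · simp
  unfold selectValue
  refine (Finset.sum_le_sum fun t _ => hterm t).trans (le_of_eq ?_)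
  rw [Finset.sum_const, Finset.card_univ, Fintype.card_fin, nsmul_eq_mul,
    ← ENNReal.ofReal_natCast, ← ENNReal.ofReal_mul (by positivity)]
  congr 1
  push_cast
  field_simp

/-- The indicator of the transcripts whose selected point violates the bound `C * rate`. -/
noncomputable def violation (P : Params) (f : E d → X → ℝ) (S : Fin n → X) (C Φ₀ : ℝ) :
    Transcript d → ℝ≥0∞ :=
  Set.indicator {o | C * stationarityRate P d n Φ₀ o.1 <
    ‖gradient (empiricalRisk f S) o.selected‖} 1

lemma measurableSet_violation (hge : Measurable fun w => gradient (empiricalRisk f S) w)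
    (C Φ₀ : ℝ) : MeasurableSet {o : Transcript d | C * stationarityRate P d n Φ₀ o.1 <
      ‖gradient (empiricalRisk f S) o.selected‖} := by
  refine MeasurableSpace.measurableSet_iInf.2 fun T => ?_
  have h := (hge.comp (measurable_selected.comp (measurable_sigmaMk (β := fun T : ℕ =>
    (Fin (T + 1) → E d) × Fin (T + 1)) T))).norm
  have h2 := measurableSet_lt (f := fun _ => C * stationarityRate P d n Φ₀ T) measurable_const h
  exact h2

lemma measurable_violation (hge : Measurable fun w => gradient (empiricalRisk f S) w)
    (C Φ₀ : ℝ) : Measurable (violation P f S C Φ₀) :=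
  measurable_one.indicator (measurableSet_violation hge C Φ₀)

lemma violation_le_one (C Φ₀ : ℝ) (o : Transcript d) : violation P f S C Φ₀ o ≤ 1 :=
  Set.indicator_le_self' (fun _ _ => zero_le_one) o

lemma violation_mk (hsm : IsSmoothLoss f P.L₁) (C Φ₀ : ℝ) (j : ℕ) (u : ℕ → E d)
    (t : Fin (j + 1)) : violation P f S C Φ₀ ⟨j, fun t => u t, t⟩ =
      if C * stationarityRate P d n Φ₀ j < ‖averageGradient f S (u t)‖ then 1 else 0 := by
  rw [violation, Set.indicator_apply, ← gradient_empiricalRisk hsm]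
  rfl

lemma selectValue_violation_eq_zero (hsm : IsSmoothLoss f P.L₁) {C : ℝ} {u : ℕ → E d}
    {j : ℕ} (h : ∀ t ≤ j, ‖averageGradient f S (u t)‖ ≤ C * stationarityRate P d n Φ₀ j) :
    selectValue P f S (violation P f S C Φ₀) j u = 0 := by
  refine Finset.sum_eq_zero fun t _ => ?_
  rw [violation_mk hsm, if_neg (not_lt.2 (h t (Nat.lt_succ_iff.1 t.2))), mul_zero]

/-- Since `j + 1 ≤ n√ρ`, the logarithm in the selection error is at most `Λ`; the error is then at
most twice `noiseError`, which accounts for `202 = 200 + 2`. -/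
lemma selectValue_violation_le (hsm : IsSmoothLoss f P.L₁) (hn : 0 < n) (hρ : 0 < P.ρ)
    (hL : 0 < P.L₀) (hβ : 0 < P.β) (hΛ0 : 0 ≤ logFactor P n)
    (hΛ : logFactor P n ≤ n * √P.ρ) {j : ℕ} {u : ℕ → E d} (hj : (j : ℝ) + 1 ≤ n * √P.ρ)
    (hex : ∃ t ≤ j, ‖averageGradient f S (u t)‖ ≤ 200 * stationarityRate P d n Φ₀ j) :
    selectValue P f S (violation P f S 202 Φ₀) j u ≤ ENNReal.ofReal P.β := by
  refine selectValue_le_of_exists hsm hn hρ hL hβ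
    (fun t => (violation_mk hsm _ _ j u t).le) hex ?_
  have h1 : Real.log ((j + 1) / P.β) ≤ logFactor P n :=
    Real.log_le_log (by positivity) (by gcongr)
  have h2 := mul_logFactor_le_noiseError hn hρ hL hΛ hΛ0
  have h3 : 2 * P.L₀ / (n * √P.ρ) * Real.log ((j + 1) / P.β) ≤
      2 * (P.L₀ / (n * √P.ρ) * logFactor P n) := by
    calc _ ≤ 2 * P.L₀ / (n * √P.ρ) * logFactor P n := by gcongr
      _ = _ := by ring
  have h4 := optimizationError_nonneg (P := P) (d := d) (n := n) (Φ₀ := Φ₀) j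
  rw [stationarityRate_eq]
  linarith

lemma runValue_le_one (hφ : ∀ o, φ o ≤ 1) (k j : ℕ) (u : ℕ → E d) (s : ℝ) :
    runValue P f S φ k j u s ≤ 1 := by
  induction k generalizing j u s with
  | zero => simp [runValue]
  | succ k ih =>
    refine (lintegral_mono (g := fun _ => 1) fun ξ => ?_).trans (by simp)
    dsimp only
    split_ifs
    · exact (selectValue_mono hφ j u).trans (selectValue_one j u).le
    · exact ih _ _ _

lemma normValue_le_one (hφ : ∀ o, φ o ≤ 1) (k j : ℕ) (u : ℕ → E d) (s N : ℝ) :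
    normValue P f S φ k j u s N ≤ 1 := by
  unfold normValue
  split_ifs
  · exact (selectValue_mono hφ j u).trans (selectValue_one j u).le
  · exact (lintegral_mono (g := fun _ => 1) fun b => runValue_le_one hφ _ _ _ _).trans (by simp)

lemma lintegral_gaussianReal_le {F : ℝ → ℝ≥0∞} {c : ℝ≥0∞} {r : ℝ} (hr : 0 ≤ r)
    (hF1 : ∀ z, F z ≤ 1) (hF : ∀ z, |z| ≤ r → F z ≤ c) :
    ∫⁻ z, F z ∂gaussianReal 0 1 ≤ c + ENNReal.ofReal (2 * Real.exp (-(r ^ 2 / 2))) := by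
  have hm : MeasurableSet {z : ℝ | r < |z|} := measurableSet_lt measurable_const (by fun_prop)
  calc ∫⁻ z, F z ∂gaussianReal 0 1
      ≤ ∫⁻ z, (c + {z : ℝ | r < |z|}.indicator 1 z) ∂gaussianReal 0 1 := by
        refine lintegral_mono fun z => ?_
        by_cases h : r < |z|
        · rw [Set.indicator_of_mem (show z ∈ {z : ℝ | r < |z|} from h)]
          exact (hF1 z).trans le_add_self
        · exact (hF z (not_lt.1 h)).trans le_self_add
    _ = c + gaussianReal 0 1 {z | r < |z|} := by
        rw [lintegral_add_left measurable_const, lintegral_indicator_one hm]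
        simp
    _ ≤ _ := by gcongr; exact gaussianReal_abs_gt_le hr

end Select

/-! ### The potential supermartingale and the violation probability. -/

section Convergence

open scoped RealInnerProductSpace

variable {d n : ℕ} {X : Type*} {P : Params} {f : E d → X → ℝ} {S : Fin n → X} {w₀ : E d}
  {Φ₀ : ℝ} {wstar : E d}

/-- The error due to the lower bound `2 L₀ / (n √ρ)` on the noise level. -/
noncomputable def floorError (P : Params) (d n : ℕ) : ℝ :=
  4 * P.L₀ ^ 2 * d * logFactor P n / (n ^ 2 * P.ρ)

/-- The potential: the scaled optimality gap, plus the squared gradient norms so far. -/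
noncomputable def potential (P : Params) (f : E d → X → ℝ) (S : Fin n → X) (wstar : E d) (j : ℕ)
    (u : ℕ → E d) : ℝ :=
  P.L₁ * (empiricalRisk f S (u j) - empiricalRisk f S wstar) + floorError P d n +
    1 / 16 * ∑ t ∈ Finset.range j, ‖averageGradient f S (u t)‖ ^ 2

/-- The bound on the conditional probability that the potential ends up above `c`. -/
noncomputable def excessBound (P : Params) (n : ℕ) (c Q s : ℝ) : ℝ :=
  (Q / c) ^ (logFactor P n / 2) * Real.exp ((P.ρ / 2 - s) / (2 * P.ρ))

/-- Upper bound on the privacy cost of iteration `t`, if the noise on its gradient norm is small. -/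
noncomputable def costBound (P : Params) (f : E d → X → ℝ) (S : Fin n → X) (u : ℕ → E d)
    (t : ℕ) : ℝ :=
  P.L₀ ^ 2 * d * logFactor P n / (0.81 * n ^ 2 * ‖averageGradient f S (u t)‖ ^ 2) + √P.ρ / n

lemma floorError_pos (hd : 0 < d) (hn : 0 < n) (hρ : 0 < P.ρ) (hL : 0 < P.L₀)
    (hΛ : 0 < logFactor P n) : 0 < floorError P d n := by
  unfold floorError; positivity

lemma floorError_le_potential (hL₁ : 0 < P.L₁)
    (hmin : ∀ w, empiricalRisk f S wstar ≤ empiricalRisk f S w) (j : ℕ) (u : ℕ → E d) :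
    floorError P d n ≤ potential P f S wstar j u := by
  have h1 : 0 ≤ P.L₁ * (empiricalRisk f S (u j) - empiricalRisk f S wstar) :=
    mul_nonneg hL₁.le (sub_nonneg.2 (hmin _))
  have h2 : 0 ≤ ∑ t ∈ Finset.range j, ‖averageGradient f S (u t)‖ ^ 2 := by positivity
  unfold potential
  linarith

lemma sq_norm_averageGradient_le (hn : 0 < n) (hL₁ : 0 < P.L₁) (hsm : IsSmoothLoss f P.L₁)
    (hmin : ∀ w, empiricalRisk f S wstar ≤ empiricalRisk f S w) (w : E d) :
    ‖averageGradient f S w‖ ^ 2 ≤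
      2 * (P.L₁ * (empiricalRisk f S w - empiricalRisk f S wstar)) :=
  sq_norm_gradient_le_of_lipschitz_gradient hL₁ (hasGradientAt_empiricalRisk hsm S)
    (norm_averageGradient_sub_le hn hsm S) hmin w

/-- Of the descent `3/8 * ‖g‖ ^ 2`, the share `1/16` pays for the new term of the running sum and
`5/16` remains. -/
lemma potential_update_le (hn : 0 < n) (hL₁ : 0 < P.L₁) (hsm : IsSmoothLoss f P.L₁) (j : ℕ)
    (u : ℕ → E d) (b : E d) :
    potential P f S wstar (j + 1) (Function.update u (j + 1)
      (u j - (1 / (2 * P.L₁)) • (averageGradient f S (u j) + b))) ≤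
      potential P f S wstar j u + (-(5 / 16) * ‖averageGradient f S (u j)‖ ^ 2 -
        1 / 4 * ⟪averageGradient f S (u j), b⟫ + 1 / 8 * ‖b‖ ^ 2) := by
  have h := noisy_step_le hL₁ (hasGradientAt_empiricalRisk hsm S)
    (norm_averageGradient_sub_le hn hsm S) (u j) b
  have hsum : ∑ t ∈ Finset.range (j + 1), ‖averageGradient f S (Function.update u (j + 1)
      (u j - (1 / (2 * P.L₁)) • (averageGradient f S (u j) + b)) t)‖ ^ 2 =
      ∑ t ∈ Finset.range (j + 1), ‖averageGradient f S (u t)‖ ^ 2 := by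
    refine Finset.sum_congr rfl fun t ht => ?_
    rw [Function.update_of_ne (by have := Finset.mem_range.1 ht; omega)]
  unfold potential
  rw [hsum, Function.update_self, Finset.sum_range_succ]
  linarith

lemma privacyCost_le_costBound (hn : 0 < n) (hΛ : 0 < logFactor P n) {u : ℕ → E d} {t : ℕ}
    {N : ℝ} (hG : 0 < ‖averageGradient f S (u t)‖)
    (hN : 0.9 * ‖averageGradient f S (u t)‖ ≤ N) :
    privacyCost P d n N ≤ costBound P f S u t := by
  have hN0 : 0 < N := lt_of_lt_of_le (by positivity) hN
  unfold privacyCost costBound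
  rw [if_pos hN0]
  gcongr
  refine (min_le_left _ _).trans (div_le_div_of_nonneg_left (by positivity) (by positivity) ?_)
  have h1 := pow_le_pow_left₀ (by positivity) hN 2
  calc 0.81 * n ^ 2 * ‖averageGradient f S (u t)‖ ^ 2
      = n ^ 2 * (0.9 * ‖averageGradient f S (u t)‖) ^ 2 := by ring
    _ ≤ _ := by gcongr

/-- Either the noise level is proportional to the noisy gradient norm, or the lower bound on the
noise level is active, and the iteration uses a fixed fraction of the budget. -/
lemma gradNoiseScale_cases (hd : 0 < d) (hn : 0 < n) (hρ : 0 < P.ρ)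
    (hΛ : 0 < logFactor P n) {N : ℝ} (hN : 0 < N) :
    d * logFactor P n * gradNoiseScale P d n N ^ 2 = N ^ 2 ∨
      (d * logFactor P n * gradNoiseScale P d n N ^ 2 = floorError P d n ∧
        P.ρ / 4 ≤ privacyCost P d n N) := by
  have hd' : (0 : ℝ) < d := by exact_mod_cast hd
  have hn' : (0 : ℝ) < n := by exact_mod_cast hn
  have hsq : 0 < √P.ρ := Real.sqrt_pos.2 hρ
  have hdΛ : 0 < √(d * logFactor P n) := Real.sqrt_pos.2 (by positivity)
  have hfl : d * logFactor P n * (2 * P.L₀ / (n * √P.ρ)) ^ 2 = floorError P d n := by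
    rw [div_pow, mul_pow, mul_pow, Real.sq_sqrt hρ.le, floorError]
    ring
  rcases le_total (2 * P.L₀ / (n * √P.ρ)) (N / √(d * logFactor P n)) with h | h
  · left
    rw [gradNoiseScale, max_eq_left h, div_pow, Real.sq_sqrt (by positivity)]
    field_simp
  · right
    rw [gradNoiseScale, max_eq_right h]
    refine ⟨hfl, ?_⟩
    -- An active floor means `N ^ 2 ≤ floorError`, which forces the adaptive cost to be at least `ρ
    -- / 4`.
    have h2 := pow_le_pow_left₀ (by positivity) h 2
    rw [div_pow, Real.sq_sqrt (by positivity), div_le_iff₀ (by positivity), mul_comm, hfl,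
      floorError, le_div_iff₀ (by positivity)] at h2
    unfold privacyCost
    rw [if_pos hN]
    have h3 : P.ρ / 4 ≤ min (P.L₀ ^ 2 * d * logFactor P n / ((n : ℝ) ^ 2 * N ^ 2)) (P.ρ / 2) := by
      refine le_min ?_ (by linarith)
      rw [le_div_iff₀ (by positivity)]
      linarith
    have : 0 ≤ √P.ρ / n := by positivity
    linarith

lemma excessBound_nonneg {c Q s : ℝ} (hc : 0 < c) (hQ : 0 ≤ Q) :
    0 ≤ excessBound P n c Q s := by
  unfold excessBound; positivity

/-- `excessBound` is a supermartingale along the iterations with small noise on the norm. -/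
lemma lintegral_excessBound_le (hd : 0 < d) (hn : 0 < n) (hρ : 0 < P.ρ) (hL : 0 < P.L₀)
    (hL₁ : 0 < P.L₁) (hΛ : 3 / 2 ≤ logFactor P n) (hsm : IsSmoothLoss f P.L₁)
    (hmin : ∀ w, empiricalRisk f S wstar ≤ empiricalRisk f S w) {c : ℝ} (hc : 0 < c)
    (j : ℕ) (u : ℕ → E d) (s : ℝ) {N : ℝ} (hN : 0 < N)
    (hNG : N ≤ 1.1 * ‖averageGradient f S (u j)‖) :
    ∫⁻ b, ENNReal.ofReal (excessBound P n c (potential P f S wstar (j + 1)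
      (Function.update u (j + 1) (u j - (1 / (2 * P.L₁)) •
        (averageGradient f S (u j) + gradNoiseScale P d n N • b))))
        (s + privacyCost P d n N)) ∂stdGaussian (E d) ≤
      ENNReal.ofReal (excessBound P n c (potential P f S wstar j u) s) := by
  have hΛ0 : 0 < logFactor P n := by linarith
  have hfl := floorError_pos hd hn hρ hL hΛ0
  have hQfl := floorError_le_potential (d := d) hL₁ hmin j u
  have hGQ : ‖averageGradient f S (u j)‖ ^ 2 ≤ 2 * potential P f S wstar j u := by
    have h1 := sq_norm_averageGradient_le hn hL₁ hsm hmin (u j)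
    have h2 : 0 ≤ ∑ t ∈ Finset.range j, ‖averageGradient f S (u t)‖ ^ 2 := by positivity
    unfold potential
    linarith
  have hcost : 0 ≤ privacyCost P d n N :=
    le_trans (by positivity) (privacyCost_ge hd hn hρ hΛ0 N)
  have hfr : Module.finrank ℝ (E d) = d := by simp
  set Q := potential P f S wstar j u with hQdef
  have hQ : 0 < Q := hfl.trans_le hQfl
  set g := averageGradient f S (u j) with hg
  set σ := gradNoiseScale P d n N with hσ
  set Λ := logFactor P n with hΛdef
  set γ := privacyCost P d n N with hγ
  -- The correction `δ` is the cost over `2ρ`: at least `1/8` when the floor is active, and exactly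
  -- the decrease of the exponent in `excessBound`.
  have hmgf := lintegral_exp_step_le (V := E d) (g := g) (Q := Q) (Λ := Λ) (σ := σ)
    (δ := γ / (2 * P.ρ)) (by rw [hfr]; exact hd) hQ hGQ hΛ (by
      rw [hfr]
      rcases gradNoiseScale_cases hd hn hρ hΛ0 hN with h | ⟨h, h'⟩
      · left
        refine ⟨h.le.trans ?_, by positivity⟩
        have := pow_le_pow_left₀ hN.le hNG 2
        linarith [mul_pow 1.1 ‖g‖ 2]
      · right
        refine ⟨h.le.trans hQfl, ?_⟩
        rw [le_div_iff₀ (by positivity)]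
        linarith)
  set A := (Q / c) ^ (Λ / 2) * Real.exp ((P.ρ / 2 - (s + γ)) / (2 * P.ρ)) with hA
  have hA0 : 0 ≤ A := by positivity
  have hpt : ∀ b : E d, ENNReal.ofReal (excessBound P n c (potential P f S wstar (j + 1)
      (Function.update u (j + 1) (u j - (1 / (2 * P.L₁)) • (g + σ • b)))) (s + γ)) ≤
      ENNReal.ofReal A * ENNReal.ofReal (Real.exp (Λ / 2 * ((-(5 / 16) * ‖g‖ ^ 2 -
        1 / 4 * ⟪g, σ • b⟫ + 1 / 8 * ‖σ • b‖ ^ 2) / Q))) := by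
    intro b
    rw [← ENNReal.ofReal_mul hA0]
    refine ENNReal.ofReal_le_ofReal ?_
    have h1 := potential_update_le (S := S) (wstar := wstar) hn hL₁ hsm j u (σ • b)
    have h0 := hfl.le.trans (floorError_le_potential (d := d) hL₁ hmin (j + 1)
      (Function.update u (j + 1) (u j - (1 / (2 * P.L₁)) • (g + σ • b))))
    set Q' := potential P f S wstar (j + 1)
      (Function.update u (j + 1) (u j - (1 / (2 * P.L₁)) • (g + σ • b)))
    set R := -(5 / 16) * ‖g‖ ^ 2 - 1 / 4 * ⟪g, σ • b⟫ + 1 / 8 * ‖σ • b‖ ^ 2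
    -- From `Q' ≤ Q + R` and `1 + x ≤ exp x`: additive changes become multiplicative, as needed for
    -- powers of `Q`.
    have h2 : Q' ≤ Q * Real.exp (R / Q) := by
      have h3 := Real.add_one_le_exp (R / Q)
      have h4 : Q * (R / Q + 1) = Q + R := by field_simp; ring
      have := mul_le_mul_of_nonneg_left h3 hQ.le
      linarith
    have h3 : (Q' / c) ^ (Λ / 2) ≤ (Q / c) ^ (Λ / 2) * Real.exp (Λ / 2 * (R / Q)) := by
      calc (Q' / c) ^ (Λ / 2) ≤ (Q / c * Real.exp (R / Q)) ^ (Λ / 2) := by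
            refine Real.rpow_le_rpow (by positivity) ?_ (by positivity)
            rw [div_mul_eq_mul_div]
            gcongr
        _ = _ := by
            rw [Real.mul_rpow (by positivity) (by positivity), ← Real.exp_mul, mul_comm (R / Q)]
    rw [excessBound, hA, mul_right_comm]
    gcongr
  refine (lintegral_mono hpt).trans ?_
  rw [lintegral_const_mul' _ _ ENNReal.ofReal_ne_top]
  refine (mul_le_mul_right hmgf _).trans ?_
  rw [← ENNReal.ofReal_mul hA0]
  refine ENNReal.ofReal_le_ofReal (le_of_eq ?_)
  rw [hA, mul_assoc, ← Real.exp_add, excessBound]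
  congr 2
  field_simp
  ring

/-- Parameters for which the convergence bound is not trivial. -/
structure IsNontrivial (P : Params) (d n : ℕ) : Prop where
  d_pos : 0 < d
  n_pos : 0 < n
  ρ_pos : 0 < P.ρ
  L₀_pos : 0 < P.L₀
  L₁_pos : 0 < P.L₁
  β_pos : 0 < P.β
  two_le : 2 ≤ n * √P.ρ
  logFactor_ge : 3 / 2 ≤ logFactor P n
  logFactor_le : logFactor P n ≤ n * √P.ρ

namespace IsNontrivial

lemma logFactor_pos (h : IsNontrivial P d n) : 0 < logFactor P n := by
  linarith [h.logFactor_ge]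

lemma exp_neg_logFactor (h : IsNontrivial P d n) :
    Real.exp (-logFactor P n) = P.β / (n * √P.ρ) := by
  have := h.β_pos
  have := h.two_le
  rw [logFactor, Real.exp_neg, Real.exp_log (by positivity), inv_div]

/-- The flat charges within the budget give `j ≤ n√ρ / 2`, and `2 ≤ n√ρ` absorbs the extra `1`. -/
lemma add_one_le (h : IsNontrivial P d n) {j : ℕ} {s : ℝ} (hj : j * (√P.ρ / n) ≤ s)
    (hs : s ≤ P.ρ / 2) : (j : ℝ) + 1 ≤ n * √P.ρ := by
  have hn' : (0 : ℝ) < n := by exact_mod_cast h.n_pos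
  have hsq : 0 < √P.ρ := Real.sqrt_pos.2 h.ρ_pos
  have h1 : j * √P.ρ ≤ n * √P.ρ / 2 * √P.ρ := by
    have h2 := hj.trans hs
    rw [← mul_div_assoc, div_le_iff₀ hn'] at h2
    have h3 : n * √P.ρ / 2 * √P.ρ = n / 2 * (√P.ρ * √P.ρ) := by ring
    rw [h3, Real.mul_self_sqrt h.ρ_pos.le]
    linarith
  have h2 := le_of_mul_le_mul_right h1 hsq
  linarith [h.two_le]

/-- The threshold `2√Λ` gives `2 * exp (-2Λ)`; as `exp Λ ≥ 2`, this is at most `exp (-Λ)`, small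
enough for a union bound over the run. -/
lemma tail_le (h : IsNontrivial P d n) :
    2 * Real.exp (-((2 * √(logFactor P n)) ^ 2 / 2)) ≤ P.β / (n * √P.ρ) := by
  rw [mul_pow, Real.sq_sqrt h.logFactor_pos.le, ← h.exp_neg_logFactor]
  have h1 : 2 ≤ Real.exp (logFactor P n) := by
    have := Real.add_one_le_exp (logFactor P n)
    linarith [h.logFactor_ge]
  have h2 : -(2 ^ 2 * logFactor P n / 2) = -logFactor P n + -logFactor P n := by ring
  have h3 : 2 * Real.exp (-logFactor P n) ≤ 1 := by
    rw [Real.exp_neg, ← div_eq_mul_inv, div_le_one (Real.exp_pos _)]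
    exact h1
  rw [h2, Real.exp_add, ← mul_assoc]
  exact mul_le_of_le_one_left (Real.exp_pos _).le h3

lemma noisyNorm_bounds (h : IsNontrivial P d n) {w : E d} {z : ℝ}
    (hG : 20 * noiseError P n ≤ ‖averageGradient f S w‖) (hz : |z| ≤ 2 * √(logFactor P n)) :
    0.9 * ‖averageGradient f S w‖ ≤ noisyNorm P f S w z ∧
      noisyNorm P f S w z ≤ 1.1 * ‖averageGradient f S w‖ := by
  have hn' : (0 : ℝ) < n := by exact_mod_cast h.n_pos
  have hτ : 0 ≤ normNoiseScale P n := by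
    have := h.ρ_pos
    have := h.L₀_pos
    unfold normNoiseScale; positivity
  have h1 : |normNoiseScale P n * z| ≤ 2 * noiseError P n := by
    rw [abs_mul, abs_of_nonneg hτ, noiseError_eq_mul_normNoiseScale]
    calc normNoiseScale P n * |z| ≤ normNoiseScale P n * (2 * √(logFactor P n)) := by gcongr
      _ = _ := by ring
  have h2 := abs_le.1 h1
  unfold noisyNorm
  constructor <;> linarith [h2.1, h2.2]

end IsNontrivial

/-- A good iterate stays available for selection whatever happens later, so only the selection can
fail. -/
lemma runValue_violation_le_of_exists (h : IsNontrivial P d n) (hsm : IsSmoothLoss f P.L₁)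
    (k : ℕ) {j : ℕ} {u : ℕ → E d} {s : ℝ} (hj : j * (√P.ρ / n) ≤ s) (hs : s ≤ P.ρ / 2)
    (hex : ∃ t ≤ j, ‖averageGradient f S (u t)‖ ≤ 20 * noiseError P n) :
    runValue P f S (violation P f S 202 Φ₀) k j u s ≤ ENNReal.ofReal P.β := by
  induction k generalizing j u s with
  | zero => simp [runValue]
  | succ k ih =>
    refine (lintegral_mono (g := fun _ => ENNReal.ofReal P.β) fun ξ => ?_).trans (by simp)
    dsimp only
    split_ifs with hexit
    · refine selectValue_violation_le hsm h.n_pos h.ρ_pos h.L₀_pos h.β_pos h.logFactor_pos.le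
        h.logFactor_le (h.add_one_le hj hs) ?_
      obtain ⟨t, ht, hle⟩ := hex
      refine ⟨t, ht, hle.trans ?_⟩
      have h1 := optimizationError_nonneg (P := P) (d := d) (n := n) (Φ₀ := Φ₀) j
      have h2 := noiseError_pos h.n_pos h.ρ_pos h.L₀_pos h.logFactor_pos
      rw [stationarityRate_eq]
      linarith
    · refine ih ?_ (not_lt.1 hexit) ?_
      · have h1 := privacyCost_ge h.d_pos h.n_pos h.ρ_pos h.logFactor_pos
          (noisyNorm P f S (u j) ξ.1)
        simp only [agdStep]
        push_cast
        linarith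
      · obtain ⟨t, ht, hle⟩ := hex
        exact ⟨t, by omega, by rwa [Function.update_of_ne (by omega)]⟩

lemma exp_four_le : Real.exp 4 ≤ 55 := by
  have h : Real.exp 4 = Real.exp 1 ^ 4 := by rw [← Real.exp_nat_mul]; norm_num
  rw [h]
  calc Real.exp 1 ^ 4 ≤ 2.7182818286 ^ 4 := by
        gcongr; exact Real.exp_one_lt_d9.le
    _ ≤ 55 := by norm_num

lemma one_le_excessBound (h : IsNontrivial P d n) {c Q s : ℝ} (hc : 0 < c) (hQ : c ≤ Q)
    (hs : s ≤ P.ρ / 2) : 1 ≤ excessBound P n c Q s := by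
  have := h.logFactor_pos
  have := h.ρ_pos
  unfold excessBound
  refine one_le_mul_of_one_le_of_one_le ?_ ?_
  · exact Real.one_le_rpow ((one_le_div hc).2 hQ) (by positivity)
  · exact Real.one_le_exp (div_nonneg (by linarith) (by positivity))

lemma potential_nonneg (h : IsNontrivial P d n)
    (hmin : ∀ w, empiricalRisk f S wstar ≤ empiricalRisk f S w) (j : ℕ) (u : ℕ → E d) :
    0 ≤ potential P f S wstar j u :=
  (floorError_pos h.d_pos h.n_pos h.ρ_pos h.L₀_pos h.logFactor_pos).le.trans
    (floorError_le_potential h.L₁_pos hmin j u)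

/-- When the budget is exhausted, a violation is unlikely unless the potential is large. -/
lemma selectValue_violation_le_of_potential_le (h : IsNontrivial P d n)
    (hsm : IsSmoothLoss f P.L₁)
    (hmin : ∀ w, empiricalRisk f S wstar ≤ empiricalRisk f S w) (hΦ : 0 ≤ Φ₀)
    {j : ℕ} {u : ℕ → E d} {s : ℝ} (hj : j * (√P.ρ / n) ≤ s) (hs : s ≤ P.ρ / 2)
    (hG : ∀ t ≤ j, 20 * noiseError P n < ‖averageGradient f S (u t)‖)
    (hcost : P.ρ / 2 < ∑ t ∈ Finset.range (j + 1), costBound P f S u t)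
    (hQ : potential P f S wstar j u ≤ 500 * (Φ₀ * P.L₁)) :
    selectValue P f S (violation P f S 202 Φ₀) j u ≤ ENNReal.ofReal P.β := by
  have ha := noiseError_pos h.n_pos h.ρ_pos h.L₀_pos h.logFactor_pos
  have hfl := floorError_pos h.d_pos h.n_pos h.ρ_pos h.L₀_pos h.logFactor_pos
  have hgap : 0 ≤ P.L₁ * (empiricalRisk f S (u j) - empiricalRisk f S wstar) :=
    mul_nonneg h.L₁_pos.le (sub_nonneg.2 (hmin _))
  have hsum0 : 0 ≤ ∑ t ∈ Finset.range j, ‖averageGradient f S (u t)‖ ^ 2 := by positivity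
  have hlast := sq_norm_averageGradient_le h.n_pos h.L₁_pos hsm hmin (u j)
  obtain ⟨t, ht, hle⟩ := exists_le_mul_optimizationError (d := d) (T := j) h.n_pos h.ρ_pos
    h.L₀_pos h.L₁_pos h.logFactor_pos hΦ (G := fun t => ‖averageGradient f S (u t)‖)
    (fun t ht => by linarith [hG t ht]) hQ (by unfold potential; linarith)
    (by unfold potential; linarith) hcost
  refine selectValue_violation_le hsm h.n_pos h.ρ_pos h.L₀_pos h.β_pos
    h.logFactor_pos.le h.logFactor_le (h.add_one_le hj hs) ⟨t, ht, hle.trans ?_⟩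
  rw [stationarityRate_eq]
  linarith

/-- The induction step for an accurate `N`. On exit, a potential of at least `c` makes `excessBound`
at least `1`, and a smaller one leaves only the selection error. On continuation, a small new
gradient is covered by `runValue_violation_le_of_exists`; otherwise `ih` applies, and averaging uses
the supermartingale property. -/
lemma normValue_violation_le (h : IsNontrivial P d n) (hsm : IsSmoothLoss f P.L₁)
    (hmin : ∀ w, empiricalRisk f S wstar ≤ empiricalRisk f S w) (hΦ : 0 ≤ Φ₀) {c : ℝ}
    (hc : 0 < c) (hcΦ : c ≤ 500 * (Φ₀ * P.L₁))
    (k : ℕ) {j : ℕ} {u : ℕ → E d} {s : ℝ} (hj : j * (√P.ρ / n) ≤ s) (hs : s ≤ P.ρ / 2)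
    (hG : ∀ t ≤ j, 20 * noiseError P n < ‖averageGradient f S (u t)‖)
    (hsG : s ≤ ∑ t ∈ Finset.range j, costBound P f S u t)
    (ih : ∀ {u : ℕ → E d} {s : ℝ}, ((j + 1 : ℕ) : ℝ) * (√P.ρ / n) ≤ s → s ≤ P.ρ / 2 →
      (∀ t ≤ j + 1, 20 * noiseError P n < ‖averageGradient f S (u t)‖) →
      s ≤ ∑ t ∈ Finset.range (j + 1), costBound P f S u t →
      runValue P f S (violation P f S 202 Φ₀) k (j + 1) u s ≤
        ENNReal.ofReal (P.β + k * (P.β / (n * √P.ρ)) +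
          excessBound P n c (potential P f S wstar (j + 1) u) s))
    {N : ℝ} (hN1 : 0.9 * ‖averageGradient f S (u j)‖ ≤ N)
    (hN2 : N ≤ 1.1 * ‖averageGradient f S (u j)‖) :
    normValue P f S (violation P f S 202 Φ₀) k j u s N ≤
      ENNReal.ofReal (P.β + k * (P.β / (n * √P.ρ)) +
        excessBound P n c (potential P f S wstar j u) s) := by
  have hβ := h.β_pos
  have hm : 0 < n * √P.ρ := by linarith [h.two_le]
  have hkβ : 0 ≤ k * (P.β / (n * √P.ρ)) := by positivity
  have hex0 : ∀ j u s, 0 ≤ excessBound P n c (potential P f S wstar j u) s := fun j u s =>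
    excessBound_nonneg hc (potential_nonneg h hmin j u)
  have ha := noiseError_pos h.n_pos h.ρ_pos h.L₀_pos h.logFactor_pos
  have hGj0 : 0 < ‖averageGradient f S (u j)‖ := by linarith [hG j le_rfl]
  have hN0 : 0 < N := lt_of_lt_of_le (by positivity) hN1
  have hcost := privacyCost_le_costBound (P := P) h.n_pos h.logFactor_pos hGj0 hN1
  unfold normValue
  split_ifs with hexit
  · by_cases hQ : c ≤ potential P f S wstar j u
    · refine (selectValue_mono (violation_le_one 202 Φ₀) j u).trans ?_
      rw [selectValue_one, ← ENNReal.ofReal_one]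
      refine ENNReal.ofReal_le_ofReal ?_
      linarith [one_le_excessBound h hc hQ hs]
    · refine (selectValue_violation_le_of_potential_le h hsm hmin hΦ hj hs hG ?_
        ((not_le.1 hQ).le.trans hcΦ)).trans (ENNReal.ofReal_le_ofReal (by linarith [hex0 j u s]))
      rw [Finset.sum_range_succ]
      linarith
  · have hs' := not_lt.1 hexit
    have hj' : ((j + 1 : ℕ) : ℝ) * (√P.ρ / n) ≤ s + privacyCost P d n N := by
      have := privacyCost_ge h.d_pos h.n_pos h.ρ_pos h.logFactor_pos N
      push_cast
      linarith
    have hub : ∀ (w : E d) t, t ≤ j → Function.update u (j + 1) w t = u t := fun w t ht =>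
      Function.update_of_ne (by omega) _ _
    have hw : ∀ w : E d, runValue P f S (violation P f S 202 Φ₀) k (j + 1)
        (Function.update u (j + 1) w) (s + privacyCost P d n N) ≤
        ENNReal.ofReal (P.β + k * (P.β / (n * √P.ρ))) +
          ENNReal.ofReal (excessBound P n c (potential P f S wstar (j + 1)
            (Function.update u (j + 1) w)) (s + privacyCost P d n N)) := by
      intro w
      rw [← ENNReal.ofReal_add (by positivity) (hex0 _ _ _)]
      by_cases hw : 20 * noiseError P n < ‖averageGradient f S w‖
      · refine ih hj' hs' (fun t ht => ?_) ?_
        · rcases Nat.lt_or_ge t (j + 1) with h1 | h1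
          · rw [hub w t (by omega)]
            exact hG t (by omega)
          · have : t = j + 1 := by omega
            subst this
            rwa [Function.update_self]
        · have hcb : ∑ t ∈ Finset.range (j + 1), costBound P f S (Function.update u (j + 1) w) t
              = ∑ t ∈ Finset.range (j + 1), costBound P f S u t := by
            refine Finset.sum_congr rfl fun t ht => ?_
            simp only [costBound]
            rw [hub w t (Nat.lt_succ_iff.1 (Finset.mem_range.1 ht))]
          rw [hcb, Finset.sum_range_succ]
          linarith
      · refine (runValue_violation_le_of_exists h hsm k hj' hs' ⟨j + 1, le_rfl, ?_⟩).trans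
          (ENNReal.ofReal_le_ofReal ?_)
        · rw [Function.update_self]
          exact not_lt.1 hw
        · linarith [hex0 (j + 1) (Function.update u (j + 1) w) (s + privacyCost P d n N)]
    refine (lintegral_mono fun b => hw _).trans ?_
    rw [lintegral_add_left measurable_const, lintegral_const, measure_univ, mul_one,
      ENNReal.ofReal_add (by positivity) (hex0 j u s)]
    gcongr
    exact lintegral_excessBound_le h.d_pos h.n_pos h.ρ_pos h.L₀_pos h.L₁_pos
      h.logFactor_ge hsm hmin hc j u s hN0 hN2

/-- The probability of a violation, while all gradients so far are large. -/
lemma runValue_violation_le (h : IsNontrivial P d n) (hsm : IsSmoothLoss f P.L₁)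
    (hmin : ∀ w, empiricalRisk f S wstar ≤ empiricalRisk f S w) (hΦ : 0 ≤ Φ₀) {c : ℝ}
    (hc : 0 < c) (hcΦ : c ≤ 500 * (Φ₀ * P.L₁))
    (k : ℕ) {j : ℕ} {u : ℕ → E d} {s : ℝ} (hj : j * (√P.ρ / n) ≤ s) (hs : s ≤ P.ρ / 2)
    (hG : ∀ t ≤ j, 20 * noiseError P n < ‖averageGradient f S (u t)‖)
    (hsG : s ≤ ∑ t ∈ Finset.range j, costBound P f S u t) :
    runValue P f S (violation P f S 202 Φ₀) k j u s ≤
      ENNReal.ofReal (P.β + k * (P.β / (n * √P.ρ)) +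
        excessBound P n c (potential P f S wstar j u) s) := by
  have hge := measurable_gradient_empiricalRisk (P := P) h.n_pos hsm S
  induction k generalizing j u s with
  | zero => simp [runValue]
  | succ k ih =>
    have hβ := h.β_pos
    have hm : 0 < n * √P.ρ := by linarith [h.two_le]
    rw [runValue_succ (measurable_averageGradient (P := P) h.n_pos hsm S) hge
      (measurable_violation hge 202 Φ₀)]
    -- An inaccurate norm is charged `β / (n√ρ)`, which raises the coefficient from `k` to `k + 1`.
    refine (lintegral_gaussianReal_le (c := ENNReal.ofReal (P.β + k * (P.β / (n * √P.ρ)) +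
        excessBound P n c (potential P f S wstar j u) s)) (r := 2 * √(logFactor P n))
        (by positivity)
        (fun z => normValue_le_one (violation_le_one 202 Φ₀) _ _ _ _ _) fun z hz => ?_).trans ?_
    · obtain ⟨hN1, hN2⟩ := h.noisyNorm_bounds (f := f) (S := S) (hG j le_rfl).le hz
      exact normValue_violation_le h hsm hmin hΦ hc hcΦ k hj hs hG hsG ih hN1 hN2
    · have hkβ : 0 ≤ k * (P.β / (n * √P.ρ)) := by positivity
      have hex0 := excessBound_nonneg (P := P) (n := n) (s := s) hc (potential_nonneg h hmin j u)
      rw [← ENNReal.ofReal_add (by linarith) (by positivity)]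
      refine ENNReal.ofReal_le_ofReal ?_
      have := h.tail_le
      push_cast
      linarith

end Convergence

/-! ### Case analysis and the final bounds. -/

section Main

variable {d n : ℕ} {X : Type*} {P : Params} {f : E d → X → ℝ} {S : Fin n → X} {w₀ : E d}
  {Φ₀ : ℝ} {wstar : E d}

/-- If the initial optimality gap is small compared with the minimal noise level, then the
algorithm stops in the first iteration unless the noise on the gradient norm is large. -/
lemma runValue_violation_le_of_small_gap (h : IsNontrivial P d n) (hsm : IsSmoothLoss f P.L₁)
    (hmin : ∀ w, empiricalRisk f S wstar ≤ empiricalRisk f S w)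
    (hΦ₀ : empiricalRisk f S w₀ - empiricalRisk f S wstar ≤ Φ₀)
    (hsmall : 8 * (Φ₀ * P.L₁) ≤ floorError P d n)
    (hG : 20 * noiseError P n < ‖averageGradient f S w₀‖) (k : ℕ) :
    runValue P f S (violation P f S 202 Φ₀) (k + 1) 0 (fun _ => w₀) 0 ≤
      ENNReal.ofReal (P.β / (n * √P.ρ)) := by
  have hρ := h.ρ_pos
  have hL := h.L₀_pos
  have hL₁ := h.L₁_pos
  have hΛ := h.logFactor_pos
  have hn' : (0 : ℝ) < n := by exact_mod_cast h.n_pos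
  have hsq : 0 < √P.ρ := Real.sqrt_pos.2 hρ
  have hge := measurable_gradient_empiricalRisk (P := P) h.n_pos hsm S
  have ha := noiseError_pos h.n_pos h.ρ_pos h.L₀_pos h.logFactor_pos
  have hgap : 0 ≤ Φ₀ := (sub_nonneg.2 (hmin w₀)).trans hΦ₀
  have hG2 : ‖averageGradient f S w₀‖ ^ 2 ≤ 2 * (Φ₀ * P.L₁) := by
    have h1 := sq_norm_averageGradient_le h.n_pos h.L₁_pos hsm hmin w₀
    have h2 := mul_le_mul_of_nonneg_left hΦ₀ hL₁.le
    linarith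
  set G := ‖averageGradient f S w₀‖ with hGdef
  have hG0 : 0 < G := by linarith
  rw [runValue_succ (measurable_averageGradient (P := P) h.n_pos hsm S) hge
    (measurable_violation hge 202 Φ₀)]
  refine (lintegral_gaussianReal_le (c := 0) (r := 2 * √(logFactor P n)) (by positivity)
    (fun z => normValue_le_one (violation_le_one 202 Φ₀) _ _ _ _ _) fun z hz => ?_).trans ?_
  · obtain ⟨hN1, hN2⟩ := h.noisyNorm_bounds (f := f) (S := S) hG.le hz
    set N := noisyNorm P f S w₀ z
    have hN0 : 0 < N := lt_of_lt_of_le (by positivity) hN1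
    -- Here `N ^ 2 ≤ 4 Φ₀ L₁ ≤ floorError / 2`, so the minimum in the cost is `ρ / 2`, and the flat
    -- charge makes the inequality strict.
    have hcost : P.ρ / 2 < 0 + privacyCost P d n N := by
      have h1 : P.ρ / 2 ≤ P.L₀ ^ 2 * d * logFactor P n / ((n : ℝ) ^ 2 * N ^ 2) := by
        rw [le_div_iff₀ (by positivity)]
        have h2 := pow_le_pow_left₀ hN0.le hN2 2
        rw [floorError, le_div_iff₀ (by positivity)] at hsmall
        have h3 : N ^ 2 ≤ 4 * (Φ₀ * P.L₁) := by
          rw [mul_pow] at h2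
          have : 0 ≤ Φ₀ * P.L₁ := by positivity
          linarith
        have h4 : N ^ 2 * (n ^ 2 * P.ρ) ≤ 4 * (Φ₀ * P.L₁) * (n ^ 2 * P.ρ) := by gcongr
        linarith
      unfold privacyCost
      rw [if_pos hN0, min_eq_right h1]
      have : 0 < √P.ρ / n := by positivity
      linarith
    have hval : normValue P f S (violation P f S 202 Φ₀) k 0 (fun _ => w₀) 0 N =
        selectValue P f S (violation P f S 202 Φ₀) 0 (fun _ => w₀) := if_pos hcost
    refine (hval.trans (selectValue_violation_eq_zero hsm fun t _ => ?_)).le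
    have hrate : G ≤ 2 * optimizationError P d n Φ₀ 0 := by
      refine le_mul_optimizationError (by norm_num) (fun h0 => absurd rfl h0) ?_
      have hm : 0 < n * √P.ρ := by positivity
      have h1 : n * √P.ρ * G ^ 2 ≤ 4 * (P.L₀ * √(Φ₀ * P.L₁ * d * logFactor P n)) := by
        refine abs_le_of_sq_le_sq' ?_ (by positivity) |>.2
        rw [mul_pow _ (G ^ 2), mul_pow 4, mul_pow P.L₀, mul_pow _ √P.ρ, Real.sq_sqrt hρ.le,
          Real.sq_sqrt (by positivity)]
        rw [floorError, le_div_iff₀ (by positivity)] at hsmall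
        have h2 : (G ^ 2) ^ 2 ≤ (2 * (Φ₀ * P.L₁)) ^ 2 := by gcongr
        have h3 : n ^ 2 * P.ρ * (G ^ 2) ^ 2 ≤ n ^ 2 * P.ρ * (2 * (Φ₀ * P.L₁)) ^ 2 := by gcongr
        have h4 := mul_le_mul_of_nonneg_left hsmall (by positivity : 0 ≤ Φ₀ * P.L₁ / 2)
        have h5 : 0 ≤ P.L₀ ^ 2 * (Φ₀ * P.L₁ * d * logFactor P n) := by positivity
        linarith
      have h2 : G ≤ 2 * √(P.L₀ * √(Φ₀ * P.L₁ * d * logFactor P n) / (n * √P.ρ)) := by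
        refine le_mul_sqrt_of_sq_le (by norm_num) ?_
        rw [← mul_div_assoc, le_div_iff₀ hm]
        linarith
      refine h2.trans ?_
      gcongr
      exact le_add_of_nonneg_right (Real.sqrt_nonneg _)
    have := optimizationError_nonneg (P := P) (d := d) (n := n) (Φ₀ := Φ₀) 0
    rw [stationarityRate_eq, ← hGdef]
    linarith
  · rw [zero_add]
    exact ENNReal.ofReal_le_ofReal h.tail_le

/-- The factor `e^4` raised to the power `Λ / 2` yields `exp (-2Λ)`; one of the two `Λ` absorbs the
initial budget correction `1/4`. -/
lemma excessBound_initial_le (h : IsNontrivial P d n) {q Q : ℝ} (hq : 0 < q) (hQ0 : 0 ≤ Q)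
    (hQ : Q ≤ q) : excessBound P n (Real.exp 4 * q) Q 0 ≤ P.β / (n * √P.ρ) := by
  have hρ := h.ρ_pos
  have hΛ := h.logFactor_ge
  rw [← h.exp_neg_logFactor, excessBound]
  have h1 : Q / (Real.exp 4 * q) ≤ Real.exp (-4) := by
    rw [div_le_iff₀ (by positivity), ← mul_assoc, ← Real.exp_add]
    simpa using hQ
  have h2 : (P.ρ / 2 - 0) / (2 * P.ρ) = 1 / 4 := by
    field_simp
    norm_num
  have h3 : 0 ≤ logFactor P n / 2 := by linarith
  rw [h2]
  calc (Q / (Real.exp 4 * q)) ^ (logFactor P n / 2) * Real.exp (1 / 4)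
      ≤ Real.exp (-4) ^ (logFactor P n / 2) * Real.exp (1 / 4) :=
        mul_le_mul_of_nonneg_right (Real.rpow_le_rpow (by positivity) h1 h3) (Real.exp_pos _).le
    _ = Real.exp (-(2 * logFactor P n) + 1 / 4) := by
        rw [← Real.exp_mul, ← Real.exp_add]
        ring_nf
    _ ≤ Real.exp (-logFactor P n) := Real.exp_le_exp.2 (by linarith)

/-- The probability of a violation, for nontrivial parameters. -/
lemma lintegral_violation_le_of_isNontrivial (h : IsNontrivial P d n)
    (hsm : IsSmoothLoss f P.L₁)
    (hmin : ∀ w, empiricalRisk f S wstar ≤ empiricalRisk f S w)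
    (hΦ₀ : empiricalRisk f S w₀ - empiricalRisk f S wstar ≤ Φ₀) :
    ∫⁻ o, violation P f S 202 Φ₀ o ∂algorithmLaw P f w₀ S ≤ ENNReal.ofReal (3 * P.β) := by
  have hρ := h.ρ_pos
  have hβ := h.β_pos
  have hL₁ := h.L₁_pos
  have h2m := h.two_le
  have hn' : (0 : ℝ) < n := by exact_mod_cast h.n_pos
  have hsq : 0 < √P.ρ := Real.sqrt_pos.2 hρ
  have hm : 0 < n * √P.ρ := by positivity
  have hge := measurable_gradient_empiricalRisk (P := P) h.n_pos hsm S
  have hgap : 0 ≤ Φ₀ := (sub_nonneg.2 (hmin w₀)).trans hΦ₀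
  have hβm : P.β / (n * √P.ρ) ≤ P.β := div_le_self hβ.le (by linarith)
  -- The depth `k + 1` must exceed every possible run length yet stay below `n√ρ`, so that the
  -- norm-noise failures sum to at most `β`.
  obtain ⟨k, hK, hKm⟩ : ∃ k : ℕ, P.ρ / 2 < ((k + 1 : ℕ) : ℝ) * (√P.ρ / n) ∧
      ((k + 1 : ℕ) : ℝ) * (P.β / (n * √P.ρ)) ≤ P.β := by
    refine ⟨⌊n * √P.ρ / 2⌋₊, ?_, ?_⟩
    · have h1 := Nat.lt_floor_add_one (n * √P.ρ / 2)
      calc P.ρ / 2 = √P.ρ * √P.ρ / 2 := by rw [Real.mul_self_sqrt hρ.le]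
        _ = n * √P.ρ / 2 * (√P.ρ / n) := by field_simp
        _ < _ := by push_cast; gcongr
    · have h1 := Nat.floor_le (by positivity : 0 ≤ n * √P.ρ / 2)
      rw [mul_div_assoc', div_le_iff₀ hm, mul_comm]
      push_cast
      gcongr
      linarith
  rw [lintegral_algorithmLaw h.d_pos h.n_pos h.ρ_pos h.logFactor_pos
    (measurable_averageGradient (P := P) h.n_pos hsm S) hge (measurable_violation hge 202 Φ₀) hK]
  have hj : ((0 : ℕ) : ℝ) * (√P.ρ / n) ≤ 0 := by simp
  have hs : (0 : ℝ) ≤ P.ρ / 2 := by positivity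
  by_cases hG : 20 * noiseError P n < ‖averageGradient f S w₀‖
  · by_cases hsmall : 8 * (Φ₀ * P.L₁) ≤ floorError P d n
    · exact (runValue_violation_le_of_small_gap h hsm hmin hΦ₀ hsmall hG _).trans
        (ENNReal.ofReal_le_ofReal (by linarith))
    · have hfl := floorError_pos h.d_pos h.n_pos h.ρ_pos h.L₀_pos h.logFactor_pos
      have hq : 0 < Φ₀ * P.L₁ + floorError P d n := by positivity
      have hpot : potential P f S wstar 0 (fun _ => w₀) ≤ Φ₀ * P.L₁ + floorError P d n := by
        have := mul_le_mul_of_nonneg_left hΦ₀ hL₁.le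
        unfold potential
        rw [Finset.sum_range_zero]
        linarith
      -- Without a small gap, `floorError < 8 Φ₀ L₁`, and `55 * 9 = 495`.
      have hc : Real.exp 4 * (Φ₀ * P.L₁ + floorError P d n) ≤ 500 * (Φ₀ * P.L₁) := by
        have h1 := mul_le_mul_of_nonneg_right exp_four_le hq.le
        have : 0 ≤ Φ₀ * P.L₁ := by positivity
        push Not at hsmall
        linarith
      have hcpos : 0 < Real.exp 4 * (Φ₀ * P.L₁ + floorError P d n) := by positivity
      have hG' : ∀ t ≤ 0, 20 * noiseError P n < ‖averageGradient f S ((fun _ : ℕ => w₀) t)‖ :=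
        fun _ _ => hG
      have hsG : (0 : ℝ) ≤ ∑ t ∈ Finset.range 0, costBound P f S (fun _ => w₀) t := by
        rw [Finset.sum_range_zero]
      refine (runValue_violation_le h hsm hmin hgap hcpos hc (k + 1) hj hs hG' hsG).trans
        (ENNReal.ofReal_le_ofReal ?_)
      have := excessBound_initial_le h hq (potential_nonneg h hmin 0 fun _ => w₀) hpot
      linarith
  · have hex : ∃ t ≤ 0, ‖averageGradient f S ((fun _ : ℕ => w₀) t)‖ ≤ 20 * noiseError P n :=
      ⟨0, le_rfl, not_lt.1 hG⟩
    exact (runValue_violation_le_of_exists h hsm (k + 1) hj hs hex).trans (ENNReal.ofReal_le_ofReal (by linarith))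

/-- If `n √ρ < 2` then the first iteration exhausts the budget. -/
lemma lintegral_violation_eq_zero_of_lt_two (hd : 0 < d) (hn : 0 < n) (hρ : 0 < P.ρ)
    (hL₁ : 0 < P.L₁) (hL : 0 < P.L₀) (hΛ : 0 < logFactor P n) (hsm : IsSmoothLoss f P.L₁)
    (hmin : ∀ w, empiricalRisk f S wstar ≤ empiricalRisk f S w)
    (hΦ₀ : empiricalRisk f S w₀ - empiricalRisk f S wstar ≤ Φ₀) (hm2 : n * √P.ρ < 2) :
    ∫⁻ o, violation P f S 202 Φ₀ o ∂algorithmLaw P f w₀ S = 0 := by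
  have hn' : (0 : ℝ) < n := by exact_mod_cast hn
  have hsq : 0 < √P.ρ := Real.sqrt_pos.2 hρ
  have hm : 0 < n * √P.ρ := by positivity
  have hge := measurable_gradient_empiricalRisk (P := P) hn hsm S
  have hgap : 0 ≤ Φ₀ := (sub_nonneg.2 (hmin w₀)).trans hΦ₀
  -- The flat charge alone exceeds the budget, so `T = 0`; the initial gradient is then bounded by
  -- `√(2 Φ₀ L₁)`, and `n√ρ < 2` compares it with the rate.
  have hc : P.ρ / 2 < √P.ρ / n := by
    rw [lt_div_iff₀ hn']
    calc P.ρ / 2 * n = √P.ρ * √P.ρ / 2 * n := by rw [Real.mul_self_sqrt hρ.le]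
      _ = n * √P.ρ * √P.ρ / 2 := by ring
      _ < 2 * √P.ρ / 2 := by gcongr
      _ = √P.ρ := by ring
  rw [lintegral_algorithmLaw hd hn hρ hΛ (measurable_averageGradient (P := P) hn hsm S) hge
    (measurable_violation hge 202 Φ₀) (K := 1) (by simpa using hc),
    runValue_succ (measurable_averageGradient (P := P) hn hsm S) hge
    (measurable_violation hge 202 Φ₀)]
  have hN : ∀ N, normValue P f S (violation P f S 202 Φ₀) 0 0 (fun _ => w₀) 0 N = 0 := by
    intro N
    have hexit : P.ρ / 2 < 0 + privacyCost P d n N := by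
      linarith [privacyCost_ge hd hn hρ hΛ N]
    have hval : normValue P f S (violation P f S 202 Φ₀) 0 0 (fun _ => w₀) 0 N =
        selectValue P f S (violation P f S 202 Φ₀) 0 (fun _ => w₀) := if_pos hexit
    refine hval.trans (selectValue_violation_eq_zero hsm fun t _ => ?_)
    have h1 := sq_norm_averageGradient_le hn hL₁ hsm hmin w₀
    have h2 := mul_le_mul_of_nonneg_left hΦ₀ hL₁.le
    have hrate : ‖averageGradient f S w₀‖ ≤ 2 * optimizationError P d n Φ₀ 0 := by
      refine le_mul_optimizationError (by norm_num) (fun h0 => absurd rfl h0) ?_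
      have h3 : ‖averageGradient f S w₀‖ ≤ 2 * √(Φ₀ * P.L₁ / (n * √P.ρ)) := by
        refine le_mul_sqrt_of_sq_le (by norm_num) ?_
        have h4 : Φ₀ * P.L₁ / 2 ≤ Φ₀ * P.L₁ / (n * √P.ρ) := by gcongr
        linarith
      refine h3.trans ?_
      gcongr
      exact le_add_of_nonneg_left (Real.sqrt_nonneg _)
    have h5 := optimizationError_nonneg (P := P) (d := d) (n := n) (Φ₀ := Φ₀) 0
    have h6 := noiseError_pos hn hρ hL hΛ
    rw [stationarityRate_eq]
    linarith
  simp only [hN, lintegral_zero]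

/-- The bound is trivial if `3β ≥ 1`, if `Λ ≥ n√ρ` (the rate exceeds `L₀`), or if `n√ρ < 2` (a
single iteration); what is left satisfies `IsNontrivial`. -/
lemma lintegral_violation_le (hd : 0 < d) (hn : 0 < n) (hρ : 0 < P.ρ) (hL : 0 < P.L₀)
    (hL₁ : 0 < P.L₁) (hβ : 0 < P.β) (hΛ : 0 < logFactor P n) (hlip : IsLipschitzLoss f P.L₀)
    (hsm : IsSmoothLoss f P.L₁)
    (hmin : ∀ w, empiricalRisk f S wstar ≤ empiricalRisk f S w)
    (hΦ₀ : empiricalRisk f S w₀ - empiricalRisk f S wstar ≤ Φ₀) :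
    ∫⁻ o, violation P f S 202 Φ₀ o ∂algorithmLaw P f w₀ S ≤ ENNReal.ofReal (3 * P.β) := by
  have hge := measurable_gradient_empiricalRisk (P := P) hn hsm S
  by_cases hβ3 : 1 ≤ 3 * P.β
  · have := isProbabilityMeasure_algorithmLaw (w₀ := w₀) hd hn hρ hΛ
      (measurable_averageGradient (P := P) hn hsm S) hge
    refine (lintegral_mono (g := fun _ => 1) (violation_le_one 202 Φ₀)).trans ?_
    rw [lintegral_one, measure_univ, ← ENNReal.ofReal_one]
    exact ENNReal.ofReal_le_ofReal hβ3
  by_cases hΛm : n * √P.ρ ≤ logFactor P n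
  · refine le_of_eq_of_le ?_ bot_le
    have hzero : ∀ o : Transcript d, violation P f S 202 Φ₀ o = 0 := fun o => by
      refine Set.indicator_of_notMem (fun ho => ?_) _
      have ho' : 202 * stationarityRate P d n Φ₀ o.1 <
        ‖gradient (empiricalRisk f S) o.selected‖ := ho
      rw [gradient_empiricalRisk hsm, stationarityRate_eq] at ho'
      have h1 := norm_averageGradient_le hL hn hlip S o.selected
      have h2 := le_noiseError_of_lt hn hρ hL hΛm
      have h3 := optimizationError_nonneg (P := P) (d := d) (n := n) (Φ₀ := Φ₀) o.1
      linarith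
    simp only [hzero, lintegral_zero]
    rfl
  by_cases hm2 : n * √P.ρ < 2
  · rw [lintegral_violation_eq_zero_of_lt_two hd hn hρ hL₁ hL hΛ hsm hmin hΦ₀ hm2]
    exact bot_le
  push Not at hβ3 hΛm hm2
  refine lintegral_violation_le_of_isNontrivial (wstar := wstar)
    ⟨hd, hn, hρ, hL, hL₁, hβ, hm2, ?_, hΛm.le⟩ hsm hmin hΦ₀
  -- From `n√ρ ≥ 2` and `β < 1/3`, the ratio exceeds `6 ≥ exp (3/2)`.
  rw [logFactor, Real.le_log_iff_exp_le (by positivity), le_div_iff₀ hβ]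
  have h1 : Real.exp (3 / 2) ≤ 6 := by
    have h4 : Real.exp (3 / 2) ^ 2 = Real.exp 1 ^ 3 := by
      rw [← Real.exp_nat_mul, ← Real.exp_nat_mul]; norm_num
    have h5 := pow_le_pow_left₀ (Real.exp_pos 1).le Real.exp_one_lt_d9.le 3
    refine abs_le_of_sq_le_sq' ?_ (by norm_num) |>.2
    rw [h4]
    refine h5.trans (by norm_num)
  have h2 := mul_le_mul_of_nonneg_right h1 hβ.le
  linarith

end Main

theorem mainTheorem5 :
    ∃ C : ℝ, 0 < C ∧
      ∀ (X : Type*) (d n : ℕ) (f : E d → X → ℝ) (P : Params) (w₀ : E d),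
        0 < d → 0 < n → 0 < P.ρ → 0 < P.L₀ → 0 < P.L₁ → 0 < P.β → P.β < n * √P.ρ →
        IsLipschitzLoss f P.L₀ → IsSmoothLoss f P.L₁ →
        -- privacy of the whole transcript `(T, w_0, …, w_T, t*)` and of the selected point
        (IsZCDP (fun S : Fin n → X => algorithmLaw P f w₀ S) (2 * P.ρ) ∧
          IsZCDP (fun S : Fin n → X => (algorithmLaw P f w₀ S).map Transcript.selected)
            (2 * P.ρ)) ∧
        -- convergence to a stationary point
        ∀ (S : Fin n → X) (wstar : E d) (Φ₀ : ℝ),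
          (∀ w, empiricalRisk f S wstar ≤ empiricalRisk f S w) →
          empiricalRisk f S w₀ - empiricalRisk f S wstar ≤ Φ₀ →
          ENNReal.ofReal (1 - 3 * P.β) ≤
            algorithmLaw P f w₀ S {o : Transcript d |
              ‖gradient (empiricalRisk f S) o.selected‖ ≤ C * stationarityRate P d n Φ₀ o.1} := by
  refine ⟨202, by norm_num, fun X d n f P w₀ hd hn hρ hL hL₁ hβ hβm hlip hsm => ?_⟩
  have hΛ : 0 < logFactor P n := Real.log_pos ((one_lt_div hβ).2 hβm)
  refine ⟨isZCDP_algorithmLaw hL hd hn hρ hΛ hlip hsm w₀, fun S wstar Φ₀ hmin hΦ₀ => ?_⟩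
  have hge := measurable_gradient_empiricalRisk (P := P) hn hsm S
  have := isProbabilityMeasure_algorithmLaw (w₀ := w₀) hd hn hρ hΛ
    (measurable_averageGradient (P := P) hn hsm S) hge
  have hms := measurableSet_violation (P := P) (n := n) hge 202 Φ₀
  have h := lintegral_violation_le (w₀ := w₀) hd hn hρ hL hL₁ hβ hΛ hlip hsm hmin hΦ₀
  unfold violation at h
  rw [lintegral_indicator_one hms] at h
  have hcompl : {o : Transcript d | ‖gradient (empiricalRisk f S) o.selected‖ ≤
      202 * stationarityRate P d n Φ₀ o.1} = {o : Transcript d |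
        202 * stationarityRate P d n Φ₀ o.1 < ‖gradient (empiricalRisk f S) o.selected‖}ᶜ := by
    ext o
    exact (not_lt (α := ℝ)).symm
  rw [hcompl, prob_compl_eq_one_sub hms, ENNReal.ofReal_sub _ (by positivity), ENNReal.ofReal_one]
  gcongr
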